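/- Let $d\ge 1$, let $\Omega\subset\mathbb R^d$ be open and bounded with boundary $\partial\Omega$, let $c(x,y)=\|x-y\|^2$, $c_\partial(x)=\inf_{y\in\partial\Omega}c(x,y)$, and let $\varepsilon>0$. Let $\mathcal M^c(\Omega)$ be the set of locally finite Borel measures $\mu$ on $\Omega$ (of possibly infinite mass) with $\mathrm{Pers}(\mu):=\int_\Omega c_\partial\,d\mu<\infty$; for such $\mu$ put $d\hat\mu:=c_\partial\,d\mu$, a finite measure of mass $\mathrm{Pers}(\mu)$. Write $m(\mu)$ for the total mass of $\mu$, $m_g(\mu,\nu)=\sqrt{m(\mu)m(\nu)}$ and $m_h(\mu,\nu)=2\left(\frac1{m(\mu)}+\frac1{m(\nu)}\right)^{-1}$. Let $\varphi(x,z)=|1-c_\partial(x)z|$ if $0\le z\le 1/c_\partial(x)$ and $\varphi(x,z)=+\infty$ otherwise; let $\mathrm{KL}(\pi|\rho)=\int(\xi\log\xi-\xi+1)\,d\rho$ with $\xi=\frac{d\pi}{d\rho}$ ($+\infty$ if $\pi\not\ll\rho$), and $R(\pi|\mu,\nu)=\frac12\left(\mathrm{KL}(\pi|\tfrac{\mu}{m(\mu)}\otimes\nu)+\mathrm{KL}(\pi|\mu\otimes\tfrac{\nu}{m(\nu)})\right)$.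 For non-zero $\alpha,\beta\in\mathcal M^c(\Omega)$ let $$\mathrm{FG}_\varepsilon(\alpha,\beta)=\inf_{\pi}\ \int c\,d\pi+\int_\Omega\varphi\Big(x,\frac{d\pi_1}{d\hat\alpha}\Big)d\hat\alpha+\int_\Omega\varphi\Big(x,\frac{d\pi_2}{d\hat\beta}\Big)d\hat\beta+\varepsilon R(\pi|\hat\alpha,\hat\beta),$$ the infimum being over finite measures $\pi$ on $\Omega\times\Omega$ with marginals $\pi_1,\pi_2$ (a divergence term is $+\infty$ without absolute continuity). A minimizer is called an optimal plan. Set $\mathrm{FG}_\varepsilon(0,\beta)=(1+\frac\varepsilon2)\mathrm{Pers}(\beta)$ and $\mathrm{FG}_\varepsilon(\alpha,0)=(1+\frac\varepsilon2)\mathrm{Pers}(\alpha)$, so that $\mathrm{FG}_\varepsilon(0,0)=0$, and let $\mathrm{SkFG}_\varepsilon(\alpha,\beta)=\mathrm{FG}_\varepsilon(\alpha,\beta)-\frac12\mathrm{FG}_\varepsilon(\alpha,\alpha)-\frac12\mathrm{FG}_\varepsilon(\beta,\beta)$. Optimal potentials for non-zero $(\alpha,\beta)$ are the pairs $(f,g)$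 of continuous functions on $\Omega$ that maximize $$\int\min(1,f/c_\partial)\,d\hat\alpha+\int\min(1,g/c_\partial)\,d\hat\beta-\varepsilon\iint\Big(\frac{e^{(f(x)+g(y)-c(x,y))/\varepsilon}}{m_g(\hat\alpha,\hat\beta)}-\frac1{m_h(\hat\alpha,\hat\beta)}\Big)d\hat\alpha(x)\,d\hat\beta(y)\in[-\infty,\infty).$$ The Sinkhorn algorithm started at continuous $(f_0,g_0)$ is $$f_{t+1}(x)=\min\Big(c_\partial(x),-\varepsilon\log\Big(c_\partial(x)\int e^{\frac{g_t-c(x,\cdot)}\varepsilon}\frac{d\hat\beta}{m_g(\hat\alpha,\hat\beta)}\Big)\Big),\quad g_{t+1}(y)=\min\Big(c_\partial(y),-\varepsilon\log\Big(c_\partial(y)\int e^{\frac{f_{t+1}-c(\cdot,y)}\varepsilon}\frac{d\hat\alpha}{m_g(\hat\alpha,\hat\beta)}\Big)\Big).$$ Then: 1. $\mathrm{FG}_\varepsilon$ and $\mathrm{SkFG}_\varepsilon$ are $1$-homogeneous: for $\alpha,\beta\in\mathcal M^c(\Omega)$ and $\lambda\ge0$, $\mathrm{FG}_\varepsilon(\lambda\alpha,\lambda\beta)=\lambda\,\mathrm{FG}_\varepsilon(\alpha,\beta)$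 and $\mathrm{SkFG}_\varepsilon(\lambda\alpha,\lambda\beta)=\lambda\,\mathrm{SkFG}_\varepsilon(\alpha,\beta)$. For non-zero $\alpha,\beta\in\mathcal M^c(\Omega)$ and $\lambda>0$, the Sinkhorn sequence $(f_t,g_t)_t$ for $(\lambda\alpha,\lambda\beta)$ started at a given $(f_0,g_0)$ does not depend on $\lambda$; a pair $(f,g)$ is optimal for $(\lambda\alpha,\lambda\beta)$ if and only if it is optimal for $(\alpha,\beta)$; and if $\pi$ is an optimal plan for $(\alpha,\beta)$, then $\lambda\pi$ is an optimal plan for $(\lambda\alpha,\lambda\beta)$. 2. $\mathrm{FG}_\varepsilon$ is continuous with respect to the weak convergence of the renormalized measures: if $\alpha_n,\beta_n,\alpha,\beta\in\mathcal M^c(\Omega)$ (null measures allowed), $\hat\alpha_n\to\hat\alpha$ and $\hat\beta_n\to\hat\beta$ weakly (against bounded continuous functions on $\Omega$), then $\mathrm{FG}_\varepsilon(\alpha_n,\beta_n)\to\mathrm{FG}_\varepsilon(\alpha,\beta)$. This includes the null measure, where $\mathrm{FG}_\varepsilon(0,\beta)=(1+\frac\varepsilon2)\mathrm{Pers}(\beta)$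 and $\mathrm{FG}_\varepsilon(0,0)=0$. 3. Suppose that $K_\varepsilon(x,y)=e^{-c(x,y)/\varepsilon}$ is a positive definite kernel on $\Omega$, i.e. $\iint K_\varepsilon\,d(\mu-\nu)\,d(\mu-\nu)\ge0$ for all finite measures $\mu,\nu$ on $\Omega$, with equality if and only if $\mu=\nu$. Then for all $\alpha,\beta\in\mathcal M^c(\Omega)$, $\mathrm{SkFG}_\varepsilon(\alpha,\beta)\ge0$, with equality if and only if $\alpha=\beta$. -/

import Mathlib

open MeasureTheory Filter Topology InformationTheory
open scoped ENNReal NNReal BoundedContinuousFunction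

namespace ROTB

/-- The ambient Euclidean space `ℝ^d`. -/
abbrev E (d : ℕ) : Type := EuclideanSpace ℝ (Fin d)

noncomputable section

variable {d : ℕ} {Ω : Set (E d)}

/-- The cost `c(x, y) = ‖x - y‖²`. -/
def cost (x y : E d) : ℝ := ‖x - y‖ ^ 2

/-- The cost of moving `x ∈ Ω` to the boundary, `c_∂(x) = inf_{y ∈ ∂Ω} c(x, y)`. -/
def costBdry (x : Ω) : ℝ := ⨅ y : frontier Ω, cost (x : E d) (y : E d)

/-- Total persistence `Pers(μ) = ∫ c_∂ dμ`. -/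
def pers (μ : Measure Ω) : ℝ≥0∞ := ∫⁻ x, ENNReal.ofReal (costBdry x) ∂μ

/-- `μ` is a locally finite (Radon) measure on `Ω`, of possibly infinite mass, with finite total
persistence. -/
def FinPers (μ : Measure Ω) : Prop := IsLocallyFiniteMeasure μ ∧ pers μ < ∞

/-- The renormalized measure `μ̂(A) = ∫_A c_∂ dμ`. -/
def hat (μ : Measure Ω) : Measure Ω := μ.withDensity fun x => ENNReal.ofReal (costBdry x)

/-- Weak convergence: convergence of the integrals of all bounded continuous functions. -/
def WeakConv (μ : ℕ → Measure Ω) (ν : Measure Ω) : Prop :=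
  ∀ h : Ω →ᵇ ℝ, Tendsto (fun n => ∫ x, h x ∂(μ n)) atTop (𝓝 (∫ x, h x ∂ν))

/-- The spatially varying entropy function: `φ(x, z) = |1 - c_∂(x) z|` if
`0 ≤ z ≤ 1 / c_∂(x)`, and `+∞` otherwise. -/
def phi (x : Ω) (z : ℝ) : ℝ≥0∞ :=
  open Classical in
  if z ∈ Set.Icc 0 (1 / costBdry x) then ENNReal.ofReal |1 - costBdry x * z| else ∞

/-- The divergence `∫ φ(x, dμ/dν (x)) dν(x)`, equal to `+∞` if `μ` is not absolutely continuous
with respect to `ν`. -/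
def divPhi (μ ν : Measure Ω) : ℝ≥0∞ :=
  open Classical in
  if μ ≪ ν then ∫⁻ x, phi x (μ.rnDeriv ν x).toReal ∂ν else ∞

/-- `R(π | μ, ν) = ½ (KL(π | μ/m(μ) ⊗ ν) + KL(π | μ ⊗ ν/m(ν)))`, where
`KL(π | ρ) = ∫ (ξ log ξ - ξ + 1) dρ`, `ξ = dπ/dρ`. -/
def reg (π : Measure (Ω × Ω)) (μ ν : Measure Ω) : ℝ≥0∞ :=
  (klDiv π (((μ Set.univ)⁻¹ • μ).prod ν) + klDiv π (μ.prod ((ν Set.univ)⁻¹ • ν))) / 2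

/-- The primal objective. -/
def primal (ε : ℝ) (α β : Measure Ω) (π : FiniteMeasure (Ω × Ω)) : ℝ≥0∞ :=
  (∫⁻ p, ENNReal.ofReal (cost (p.1 : E d) (p.2 : E d)) ∂(π : Measure (Ω × Ω)))
    + divPhi ((π : Measure (Ω × Ω)).map Prod.fst) (hat α)
    + divPhi ((π : Measure (Ω × Ω)).map Prod.snd) (hat β)
    + ENNReal.ofReal ε * reg (π : Measure (Ω × Ω)) (hat α) (hat β)

/-- `π` is an optimal transport plan for the couple `(α, β)`. -/
def IsOptimalPlan (ε : ℝ) (α β : Measure Ω) (π : FiniteMeasure (Ω × Ω)) : Prop :=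
  ∀ π' : FiniteMeasure (Ω × Ω), primal ε α β π ≤ primal ε α β π'

/-- The regularized optimal transport cost with boundary `FG_ε`, extended to the null measure by
`FG_ε(0, β) = (1 + ε/2) Pers(β)` and `FG_ε(α, 0) = (1 + ε/2) Pers(α)`. -/
def FG (ε : ℝ) (α β : Measure Ω) : ℝ≥0∞ :=
  open Classical in
  if α = 0 then ENNReal.ofReal (1 + ε / 2) * pers β
  else if β = 0 then ENNReal.ofReal (1 + ε / 2) * pers α
  else ⨅ π : FiniteMeasure (Ω × Ω), primal ε α β π

/-- The Sinkhorn divergence `SkFG_ε` (all the terms are finite, see `FG_ne_top`). -/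
def SkFG (ε : ℝ) (α β : Measure Ω) : ℝ :=
  (FG ε α β).toReal - 1 / 2 * (FG ε α α).toReal - 1 / 2 * (FG ε β β).toReal

/-- Geometric mean of the total masses. -/
def geomMass (μ ν : Measure Ω) : ℝ := √(μ.real Set.univ * ν.real Set.univ)

/-- Harmonic mean of the total masses. -/
def harmMass (μ ν : Measure Ω) : ℝ := 2 * (1 / μ.real Set.univ + 1 / ν.real Set.univ)⁻¹

/-- The integral `∫ h dμ` of a function whose positive or negative part has a finite integral, as
an extended real number. -/
def extIntegral {X : Type*} [MeasurableSpace X] (μ : Measure X) (h : X → ℝ) : EReal :=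
  ((∫⁻ x, ENNReal.ofReal (h x) ∂μ : ℝ≥0∞) : EReal)
    - ((∫⁻ x, ENNReal.ofReal (-h x) ∂μ : ℝ≥0∞) : EReal)

/-- The dual objective. For non-zero `α, β` of finite total persistence its value lies in
`[-∞, +∞)`: the first two integrals are never `+∞` and the third one is never `-∞`. -/
def dual (ε : ℝ) (α β : Measure Ω) (f g : C(Ω, ℝ)) : EReal :=
  extIntegral (hat α) (fun x => min 1 (f x / costBdry x))
    + extIntegral (hat β) (fun y => min 1 (g y / costBdry y))
    - (ε : EReal) * extIntegral ((hat α).prod (hat β)) (fun p =>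
        Real.exp ((f p.1 + g p.2 - cost (p.1 : E d) (p.2 : E d)) / ε)
          / geomMass (hat α) (hat β) - 1 / harmMass (hat α) (hat β))

/-- `(f, g)` is a couple of optimal dual potentials for `(α, β)`. -/
def IsOptimalPotentials (ε : ℝ) (α β : Measure Ω) (f g : C(Ω, ℝ)) : Prop :=
  ∀ f' g' : C(Ω, ℝ), dual ε α β f' g' ≤ dual ε α β f g

/-- Half a Sinkhorn iteration: the potential
`x ↦ min (c_∂(x), -ε log (c_∂(x) ⟨exp((h - c(x, ·))/ε), ν / m⟩))`. -/
def sinkhornStep (ε : ℝ) (ν : Measure Ω) (m : ℝ) (h : Ω → ℝ) (x : Ω) : ℝ :=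
  min (costBdry x) (-ε * Real.log (costBdry x *
    ((∫ y, Real.exp ((h y - cost (x : E d) (y : E d)) / ε) ∂ν) / m)))

/-- The sequence `(f_t, g_t)` of potentials produced by the Sinkhorn algorithm for `(α, β)`
started at `(f₀, g₀)`: `f_{t+1}` is computed from `g_t` and `β̂`, and then `g_{t+1}` from `f_{t+1}`
and `α̂`. -/
def sinkhorn (ε : ℝ) (α β : Measure Ω) (f₀ g₀ : Ω → ℝ) : ℕ → (Ω → ℝ) × (Ω → ℝ)
  | 0 => (f₀, g₀)
  | t + 1 =>
    let f := sinkhornStep ε (hat β) (geomMass (hat α) (hat β)) (sinkhorn ε α β f₀ g₀ t).2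
    (f, sinkhornStep ε (hat α) (geomMass (hat α) (hat β)) f)

/-- `⟨μ, ν⟩_K = ∬ K(x, y) dμ(x) dν(y)`. -/
def kernelInner (K : Ω → Ω → ℝ) (μ ν : Measure Ω) : ℝ := ∫ x, ∫ y, K x y ∂ν ∂μ

/-- `K` is a positive definite kernel: for all finite measures `μ, ν`,
`‖μ - ν‖²_K = ⟨μ - ν, μ - ν⟩_K ≥ 0`, with equality if and only if `μ = ν`. -/
def IsPosDefKernel (K : Ω → Ω → ℝ) : Prop :=
  ∀ (μ ν : Measure Ω) [IsFiniteMeasure μ] [IsFiniteMeasure ν],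
    0 ≤ kernelInner K μ μ - kernelInner K μ ν - kernelInner K ν μ + kernelInner K ν ν ∧
    (kernelInner K μ μ - kernelInner K μ ν - kernelInner K ν μ + kernelInner K ν ν = 0 ↔ μ = ν)

/-- The kernel `K_ε(x, y) = exp(-c(x, y)/ε)` on `Ω`. -/
def expKernel (ε : ℝ) (x y : Ω) : ℝ := Real.exp (-cost (x : E d) (y : E d) / ε)

theorem hat_univ (μ : Measure Ω) : hat μ Set.univ = pers μ := by
  simp [hat, pers]

theorem costBdry_nonneg (x : Ω) : 0 ≤ costBdry x :=
  Real.iInf_nonneg fun _ => sq_nonneg _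

theorem divPhi_zero (ν : Measure Ω) : divPhi 0 ν = ν Set.univ := by
  have h0 : ∀ x : Ω, phi x 0 = 1 := fun x => by
    have : (0 : ℝ) ≤ 1 / costBdry x := div_nonneg zero_le_one (costBdry_nonneg x)
    simp [phi, costBdry_nonneg x]
  have h1 : (fun x => phi x ((0 : Measure Ω).rnDeriv ν x).toReal) =ᵐ[ν] fun _ => 1 := by
    filter_upwards [Measure.rnDeriv_zero ν] with x hx
    simp [hx, h0]
  have h2 : (0 : Measure Ω) ≪ ν := fun _ _ => rfl
  rw [divPhi, if_pos h2, lintegral_congr_ae h1]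
  simp

/-- `FG_ε` is finite on measures of finite total persistence. -/
theorem FG_ne_top (ε : ℝ) {α β : Measure Ω} (hα : FinPers α) (hβ : FinPers β) :
    FG ε α β ≠ ∞ := by
  have ha : hat α Set.univ ≠ ∞ := by rw [hat_univ]; exact hα.2.ne
  have hb : hat β Set.univ ≠ ∞ := by rw [hat_univ]; exact hβ.2.ne
  have : IsFiniteMeasure (hat α) := ⟨ha.lt_top⟩
  have : IsFiniteMeasure (hat β) := ⟨hb.lt_top⟩
  unfold FG
  split_ifs with h1 h2
  · exact ENNReal.mul_ne_top ENNReal.ofReal_ne_top hβ.2.ne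
  · exact ENNReal.mul_ne_top ENNReal.ofReal_ne_top hα.2.ne
  · refine ne_top_of_le_ne_top ?_ (iInf_le _ 0)
    have k : ∀ μ : Measure Ω, IsFiniteMeasure μ → IsFiniteMeasure ((μ Set.univ)⁻¹ • μ) := by
      intro μ _
      refine ⟨?_⟩
      rcases eq_or_ne (μ Set.univ) 0 with h | h
      · simp [h]
      · simp [ENNReal.inv_mul_cancel h (measure_ne_top μ _)]
    have := k (hat α) inferInstance
    have := k (hat β) inferInstance
    simp only [primal, reg, FiniteMeasure.toMeasure_zero, Measure.map_zero, divPhi_zero,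
      klDiv_zero_left, lintegral_zero_measure, zero_add]
    refine ENNReal.add_ne_top.2 ⟨ENNReal.add_ne_top.2 ⟨ha, hb⟩,
      ENNReal.mul_ne_top ENNReal.ofReal_ne_top (ENNReal.div_ne_top
        (ENNReal.add_ne_top.2 ⟨measure_ne_top _ _, measure_ne_top _ _⟩) (by norm_num))⟩

end

end ROTB

namespace ROTB

section Basic

variable {d : ℕ} {Ω : Set (E d)}

theorem costBdry_eq_infDist_sq (x : Ω) :
    costBdry x = Metric.infDist (x : E d) (frontier Ω) ^ 2 := by
  rcases (frontier Ω).eq_empty_or_nonempty with h | h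
  · have : IsEmpty (frontier Ω) := by rw [h]; infer_instance
    rw [costBdry, Real.iInf_of_isEmpty, h, Metric.infDist_empty]; norm_num
  · have : Nonempty (frontier Ω) := h.to_subtype
    obtain ⟨y, hy, hxy⟩ := isClosed_frontier.exists_infDist_eq_dist h (x : E d)
    apply le_antisymm
    · rw [hxy, dist_eq_norm]
      exact ciInf_le (f := fun y : frontier Ω => cost (x : E d) (y : E d))
        ⟨0, by rintro _ ⟨z, rfl⟩; exact sq_nonneg _⟩ ⟨y, hy⟩
    · refine le_ciInf fun z => ?_
      rw [cost, ← dist_eq_norm]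
      exact pow_le_pow_left₀ Metric.infDist_nonneg (Metric.infDist_le_dist_of_mem z.2) 2

theorem continuous_costBdry : Continuous (costBdry : Ω → ℝ) := by
  have : (costBdry : Ω → ℝ) = fun x : Ω => Metric.infDist (x : E d) (frontier Ω) ^ 2 :=
    funext costBdry_eq_infDist_sq
  rw [this]
  exact ((Metric.continuous_infDist_pt _).comp continuous_subtype_val).pow 2

theorem frontier_nonempty (hd : 0 < d) (hΩb : Bornology.IsBounded Ω) (hne : Ω.Nonempty) :
    (frontier Ω).Nonempty := by
  rw [nonempty_frontier_iff]
  refine ⟨hne, fun h => ?_⟩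
  have : Nonempty (Fin d) := ⟨⟨0, hd⟩⟩
  have : Nontrivial (E d) := inferInstance
  rw [h] at hΩb
  exact NormedSpace.unbounded_univ ℝ (E d) hΩb

theorem costBdry_pos (hd : 0 < d) (hΩ : IsOpen Ω) (hΩb : Bornology.IsBounded Ω) (x : Ω) :
    0 < costBdry x := by
  rw [costBdry_eq_infDist_sq]
  refine pow_pos ?_ 2
  have hne := frontier_nonempty hd hΩb ⟨x, x.2⟩
  rw [← isClosed_frontier.notMem_iff_infDist_pos hne, hΩ.frontier_eq]
  exact fun h => h.2 x.2

theorem exists_cost_le (hΩb : Bornology.IsBounded Ω) :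
    ∃ B : ℝ, ∀ x y : Ω, cost (x : E d) (y : E d) ≤ B := by
  obtain ⟨C, hC⟩ := Metric.isBounded_iff.1 hΩb
  refine ⟨C ^ 2, fun x y => ?_⟩
  rw [cost, ← dist_eq_norm]
  exact pow_le_pow_left₀ dist_nonneg (hC x.2 y.2) 2

theorem exists_costBdry_le (hΩb : Bornology.IsBounded Ω) :
    ∃ B : ℝ, 0 ≤ B ∧ ∀ x : Ω, costBdry x ≤ B := by
  rcases (frontier Ω).eq_empty_or_nonempty with h | ⟨y, hy⟩
  · refine ⟨0, le_rfl, fun x => ?_⟩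
    rw [costBdry_eq_infDist_sq, h, Metric.infDist_empty]; norm_num
  · obtain ⟨C, hC⟩ := Metric.isBounded_iff.1 hΩb.closure
    refine ⟨C ^ 2, sq_nonneg _, fun x => ?_⟩
    rw [costBdry_eq_infDist_sq]
    exact pow_le_pow_left₀ Metric.infDist_nonneg
      ((Metric.infDist_le_dist_of_mem hy).trans
        (hC (subset_closure x.2) (frontier_subset_closure hy))) 2

theorem continuous_cost : Continuous fun p : Ω × Ω => cost (p.1 : E d) (p.2 : E d) := by
  unfold cost; fun_prop

theorem cost_nonneg (x y : E d) : 0 ≤ cost x y := sq_nonneg _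

theorem cost_comm (x y : E d) : cost x y = cost y x := by
  rw [cost, cost, norm_sub_rev]

theorem FinPers.isFiniteMeasure_hat {μ : Measure Ω} (h : FinPers μ) : IsFiniteMeasure (hat μ) :=
  ⟨by rw [hat_univ]; exact h.2⟩

theorem withDensity_inv_hat (hpos : ∀ x : Ω, 0 < costBdry x) (μ : Measure Ω) :
    (hat μ).withDensity (fun x => (ENNReal.ofReal (costBdry x))⁻¹) = μ := by
  have hm : Measurable fun x : Ω => ENNReal.ofReal (costBdry x) :=
    continuous_costBdry.measurable.ennreal_ofReal
  have e := withDensity_mul μ hm hm.inv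
  rw [hat]
  refine e.symm.trans ?_
  convert withDensity_one (μ := μ) using 2
  ext x
  simp only [Pi.mul_apply, Pi.one_apply, Pi.inv_apply]
  exact ENNReal.mul_inv_cancel (by simpa using hpos x) ENNReal.ofReal_ne_top

theorem hat_injective (hpos : ∀ x : Ω, 0 < costBdry x) :
    Function.Injective (hat : Measure Ω → Measure Ω) := fun μ ν h => by
  rw [← withDensity_inv_hat hpos μ, ← withDensity_inv_hat hpos ν, h]

theorem hat_zero : hat (0 : Measure Ω) = 0 := by simp [hat]

theorem hat_eq_zero_iff (hpos : ∀ x : Ω, 0 < costBdry x) {μ : Measure Ω} :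
    hat μ = 0 ↔ μ = 0 := by
  conv_lhs => rw [← hat_zero, (hat_injective hpos).eq_iff]

end Basic

section Scaling

variable {d : ℕ} {Ω : Set (E d)}

theorem hat_smul (l : ℝ≥0) (μ : Measure Ω) : hat (l • μ) = l • hat μ :=
  withDensity_smul_measure (l : ℝ≥0∞) _

theorem lintegral_nnreal_smul_measure {X : Type*} [MeasurableSpace X] (l : ℝ≥0) (μ : Measure X)
    (f : X → ℝ≥0∞) : ∫⁻ x, f x ∂(l • μ) = l * ∫⁻ x, f x ∂μ :=
  lintegral_smul_measure (l : ℝ≥0∞) f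

theorem pers_smul (l : ℝ≥0) (μ : Measure Ω) : pers (l • μ) = l * pers μ :=
  lintegral_nnreal_smul_measure l μ _

theorem inv_mass_smul_smul {X : Type*} [MeasurableSpace X] {l : ℝ≥0} (hl : l ≠ 0)
    (μ : Measure X) : ((l • μ) Set.univ)⁻¹ • (l • μ) = (μ Set.univ)⁻¹ • μ := by
  have h0 : (l : ℝ≥0∞) ≠ 0 := by simpa using hl
  change (((l : ℝ≥0∞) • μ) Set.univ)⁻¹ • ((l : ℝ≥0∞) • μ) = _
  rw [smul_smul, Measure.smul_apply, smul_eq_mul,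
    ENNReal.mul_inv (Or.inl h0) (Or.inl ENNReal.coe_ne_top), mul_right_comm,
    ENNReal.inv_mul_cancel h0 ENNReal.coe_ne_top, one_mul]

theorem isFiniteMeasure_inv_mass_smul {X : Type*} [MeasurableSpace X] (μ : Measure X)
    [IsFiniteMeasure μ] : IsFiniteMeasure ((μ Set.univ)⁻¹ • μ) := by
  refine ⟨?_⟩
  rcases eq_or_ne (μ Set.univ) 0 with h | h
  · simp [h]
  · simp [ENNReal.inv_mul_cancel h (measure_ne_top μ _)]

theorem divPhi_smul {l : ℝ≥0} (hl : l ≠ 0) (μ ν : Measure Ω) [IsFiniteMeasure μ]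
    [IsFiniteMeasure ν] : divPhi (l • μ) (l • ν) = l * divPhi μ ν := by
  have h0 : (l : ℝ≥0∞) ≠ 0 := by simpa using hl
  have hac : l • μ ≪ l • ν ↔ μ ≪ ν := by
    refine ⟨fun h s hs => ?_, fun h => h.smul l⟩
    have := h (show (l • ν) s = 0 by simp [hs])
    rw [Measure.smul_apply, ENNReal.smul_def, smul_eq_mul, mul_eq_zero] at this
    exact this.resolve_left h0
  unfold divPhi
  by_cases h : μ ≪ ν
  · rw [if_pos h, if_pos (hac.2 h)]
    have h1 : (l • μ).rnDeriv (l • ν) =ᵐ[ν] μ.rnDeriv ν := by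
      have e1 := Measure.rnDeriv_smul_right (l • μ) ν hl
      have e2 := Measure.rnDeriv_smul_left μ ν l
      filter_upwards [e1, e2] with x h1 h2
      rw [h1, Pi.smul_apply, h2, Pi.smul_apply, smul_smul, inv_mul_cancel₀ hl, one_smul]
    have h2 : ∫⁻ x, phi x ((l • μ).rnDeriv (l • ν) x).toReal ∂(l • ν)
        = l * ∫⁻ x, phi x ((l • μ).rnDeriv (l • ν) x).toReal ∂ν :=
      lintegral_nnreal_smul_measure l _ _
    rw [h2]
    congr 1
    refine lintegral_congr_ae ?_
    filter_upwards [h1] with x hx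
    rw [hx]
  · rw [if_neg h, if_neg (mt hac.1 h), ENNReal.mul_top h0]

theorem reg_smul {l : ℝ≥0} (hl : l ≠ 0) (π : Measure (Ω × Ω)) (μ ν : Measure Ω)
    [IsFiniteMeasure π] [IsFiniteMeasure μ] [IsFiniteMeasure ν] :
    reg (l • π) (l • μ) (l • ν) = l * reg π μ ν := by
  have := isFiniteMeasure_inv_mass_smul μ
  have := isFiniteMeasure_inv_mass_smul ν
  have h1 : ((μ Set.univ)⁻¹ • μ).prod (l • ν) = l • ((μ Set.univ)⁻¹ • μ).prod ν :=
    Measure.prod_smul_right (l : ℝ≥0∞)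
  have h2 : (l • μ).prod ((ν Set.univ)⁻¹ • ν) = l • μ.prod ((ν Set.univ)⁻¹ • ν) :=
    Measure.prod_smul_left (l : ℝ≥0∞)
  unfold reg
  rw [inv_mass_smul_smul hl, inv_mass_smul_smul hl, h1, h2, klDiv_smul_same, klDiv_smul_same,
    ← mul_add, mul_div_assoc]

theorem primal_smul (ε : ℝ) {l : ℝ≥0} (hl : l ≠ 0) (α β : Measure Ω) [IsFiniteMeasure (hat α)]
    [IsFiniteMeasure (hat β)] (π : FiniteMeasure (Ω × Ω)) :
    primal ε (l • α) (l • β) (l • π) = l * primal ε α β π := by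
  have h1 : ((l • π : FiniteMeasure (Ω × Ω)) : Measure (Ω × Ω)) = l • (π : Measure (Ω × Ω)) := rfl
  have hm : ∀ f : Ω × Ω → Ω, (l • (π : Measure (Ω × Ω))).map f
      = l • (π : Measure (Ω × Ω)).map f := fun f => Measure.map_smul (l : ℝ≥0∞) _ f
  have hc : ∫⁻ p, ENNReal.ofReal (cost (p.1 : E d) (p.2 : E d)) ∂(l • (π : Measure (Ω × Ω)))
      = l * ∫⁻ p, ENNReal.ofReal (cost (p.1 : E d) (p.2 : E d)) ∂(π : Measure (Ω × Ω)) :=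
    lintegral_nnreal_smul_measure l _ _
  unfold primal
  rw [h1, hm, hm, hat_smul, hat_smul, divPhi_smul hl, divPhi_smul hl, reg_smul hl, hc]
  ring

theorem FG_smul (ε : ℝ) {α β : Measure Ω} (hα : FinPers α) (hβ : FinPers β) (l : ℝ≥0) :
    FG ε (l • α) (l • β) = l * FG ε α β := by
  have := hα.isFiniteMeasure_hat
  have := hβ.isFiniteMeasure_hat
  rcases eq_or_ne l 0 with rfl | hl
  · simp [FG, pers]
  have hz : ∀ μ : Measure Ω, l • μ = 0 ↔ μ = 0 := fun μ => by
    constructor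
    · intro h
      rw [← one_smul ℝ≥0 μ, ← inv_mul_cancel₀ hl, ← smul_smul, h, smul_zero]
    · rintro rfl; simp
  unfold FG
  by_cases h1 : α = 0
  · rw [if_pos h1, if_pos ((hz α).2 h1), pers_smul, mul_left_comm]
  by_cases h2 : β = 0
  · rw [if_neg h1, if_neg (mt (hz α).1 h1), if_pos h2, if_pos ((hz β).2 h2), pers_smul,
      mul_left_comm]
  rw [if_neg h1, if_neg (mt (hz α).1 h1), if_neg h2, if_neg (mt (hz β).1 h2),
    ENNReal.mul_iInf_of_ne (by simpa using hl) ENNReal.coe_ne_top]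
  refine le_antisymm (le_iInf fun π => ?_) (le_iInf fun π => ?_)
  · rw [← primal_smul ε hl]; exact iInf_le _ _
  · refine (iInf_le _ (l⁻¹ • π)).trans_eq ?_
    rw [← primal_smul ε hl, smul_smul, mul_inv_cancel₀ hl, one_smul]

theorem SkFG_smul (ε : ℝ) {α β : Measure Ω} (hα : FinPers α) (hβ : FinPers β) (l : ℝ≥0) :
    SkFG ε (l • α) (l • β) = l * SkFG ε α β := by
  unfold SkFG
  rw [FG_smul ε hα hβ, FG_smul ε hα hα, FG_smul ε hβ hβ]
  simp only [ENNReal.toReal_mul, ENNReal.coe_toReal]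
  ring

theorem IsOptimalPlan.smul {ε : ℝ} {α β : Measure Ω} (hα : FinPers α) (hβ : FinPers β)
    {l : ℝ≥0} (hl : l ≠ 0) {π : FiniteMeasure (Ω × Ω)} (h : IsOptimalPlan ε α β π) :
    IsOptimalPlan ε (l • α) (l • β) (l • π) := fun π' => by
  have := hα.isFiniteMeasure_hat
  have := hβ.isFiniteMeasure_hat
  have e : π' = l • (l⁻¹ • π') := by rw [smul_smul, mul_inv_cancel₀ hl, one_smul]
  rw [e, primal_smul ε hl, primal_smul ε hl]
  gcongr
  exact h _

theorem measureReal_univ_smul {X : Type*} [MeasurableSpace X] (l : ℝ≥0) (μ : Measure X) :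
    (l • μ).real Set.univ = l * μ.real Set.univ := by
  rw [Measure.real, Measure.smul_apply, ENNReal.smul_def, smul_eq_mul, ENNReal.toReal_mul,
    ENNReal.coe_toReal, Measure.real]

theorem geomMass_smul (l : ℝ≥0) (μ ν : Measure Ω) :
    geomMass (l • μ) (l • ν) = l * geomMass μ ν := by
  unfold geomMass
  rw [measureReal_univ_smul, measureReal_univ_smul, mul_mul_mul_comm, Real.sqrt_mul (mul_nonneg l.coe_nonneg l.coe_nonneg),
    Real.sqrt_mul_self l.coe_nonneg]

theorem harmMass_smul (l : ℝ≥0) (μ ν : Measure Ω) :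
    harmMass (l • μ) (l • ν) = l * harmMass μ ν := by
  unfold harmMass
  rw [measureReal_univ_smul, measureReal_univ_smul, one_div, one_div, mul_inv, mul_inv, ← mul_add,
    mul_inv, inv_inv, one_div, one_div]
  ring

theorem sinkhornStep_smul (ε : ℝ) {l : ℝ≥0} (hl : l ≠ 0) (ν : Measure Ω) (m : ℝ) (h : Ω → ℝ) :
    sinkhornStep ε (l • ν) (l * m) h = sinkhornStep ε ν m h := by
  funext x
  have hl' : (l : ℝ) ≠ 0 := by simpa using hl
  unfold sinkhornStep
  rw [integral_smul_nnreal_measure, NNReal.smul_def, smul_eq_mul, mul_div_mul_left _ _ hl']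

theorem sinkhorn_smul (ε : ℝ) {l : ℝ≥0} (hl : l ≠ 0) (α β : Measure Ω) (f₀ g₀ : Ω → ℝ) (t : ℕ) :
    sinkhorn ε (l • α) (l • β) f₀ g₀ t = sinkhorn ε α β f₀ g₀ t := by
  induction t with
  | zero => rfl
  | succ t ih =>
    simp only [sinkhorn, hat_smul, geomMass_smul, sinkhornStep_smul ε hl, ih]

theorem ereal_mul_add {l : ℝ≥0} (x y : EReal) :
    ((l : ℝ≥0∞) : EReal) * (x + y) = (l : ℝ≥0∞) * x + (l : ℝ≥0∞) * y :=
  EReal.left_distrib_of_nonneg_of_ne_top (EReal.coe_ennreal_nonneg _) (by simp) x y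

theorem ereal_mul_sub {l : ℝ≥0} (x y : EReal) :
    ((l : ℝ≥0∞) : EReal) * (x - y) = (l : ℝ≥0∞) * x - (l : ℝ≥0∞) * y := by
  rw [sub_eq_add_neg, ereal_mul_add, mul_neg, ← sub_eq_add_neg]

theorem extIntegral_smul_measure {X : Type*} [MeasurableSpace X] (l : ℝ≥0) (μ : Measure X)
    (h : X → ℝ) : extIntegral (l • μ) h = (l : ℝ≥0∞) * extIntegral μ h := by
  have e : ∀ f : X → ℝ≥0∞, ∫⁻ x, f x ∂(l • μ) = l * ∫⁻ x, f x ∂μ := fun f =>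
    lintegral_nnreal_smul_measure l _ _
  unfold extIntegral
  rw [e, e, ereal_mul_sub, EReal.coe_ennreal_mul, EReal.coe_ennreal_mul]

theorem extIntegral_const_mul {X : Type*} [MeasurableSpace X] (l : ℝ≥0) (μ : Measure X)
    (h : X → ℝ) : extIntegral μ (fun x => l * h x) = (l : ℝ≥0∞) * extIntegral μ h := by
  have e : ∀ f : X → ℝ, ∫⁻ x, ENNReal.ofReal (l * f x) ∂μ = l * ∫⁻ x, ENNReal.ofReal (f x) ∂μ := by
    intro f
    rw [← lintegral_const_mul' _ _ ENNReal.coe_ne_top]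
    simp [ENNReal.ofReal_mul]
  unfold extIntegral
  simp only [← mul_neg]
  rw [e, e, ereal_mul_sub, EReal.coe_ennreal_mul, EReal.coe_ennreal_mul]

theorem dual_smul (ε : ℝ) {l : ℝ≥0} (hl : l ≠ 0) (α β : Measure Ω) [IsFiniteMeasure (hat α)]
    [IsFiniteMeasure (hat β)] (f g : C(Ω, ℝ)) :
    dual ε (l • α) (l • β) f g = (l : ℝ≥0∞) * dual ε α β f g := by
  have hl' : (l : ℝ) ≠ 0 := by simpa using hl
  have hp : (l • hat α).prod (l • hat β) = l • l • (hat α).prod (hat β) := by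
    have e1 : (l • hat α).prod (l • hat β) = l • (hat α).prod (l • hat β) :=
      Measure.prod_smul_left (l : ℝ≥0∞)
    have e2 : (hat α).prod (l • hat β) = l • (hat α).prod (hat β) :=
      Measure.prod_smul_right (l : ℝ≥0∞)
    rw [e1, e2]
  unfold dual
  rw [hat_smul, hat_smul, geomMass_smul, harmMass_smul, hp, extIntegral_smul_measure,
    extIntegral_smul_measure, extIntegral_smul_measure, extIntegral_smul_measure,
    ← extIntegral_const_mul l ((hat α).prod (hat β)), ereal_mul_sub, ereal_mul_add, mul_left_comm (ε : EReal)]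
  congr 4
  funext p
  rw [mul_sub, ← mul_div_assoc, mul_div_mul_left _ _ hl', ← mul_div_assoc,
    mul_div_mul_left _ _ hl']

theorem isOptimalPotentials_smul_iff (ε : ℝ) {l : ℝ≥0} (hl : l ≠ 0) {α β : Measure Ω}
    (hα : FinPers α) (hβ : FinPers β) (f g : C(Ω, ℝ)) :
    IsOptimalPotentials ε (l • α) (l • β) f g ↔ IsOptimalPotentials ε α β f g := by
  have := hα.isFiniteMeasure_hat
  have := hβ.isFiniteMeasure_hat
  have key : ∀ {k : ℝ≥0} {x y : EReal}, x ≤ y → ((k : ℝ≥0∞) : EReal) * x ≤ (k : ℝ≥0∞) * y :=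
    fun h => mul_le_mul_of_nonneg_left h (EReal.coe_ennreal_nonneg _)
  have hinv : ∀ x : EReal, ((l⁻¹ : ℝ≥0) : ℝ≥0∞) * (((l : ℝ≥0∞) : EReal) * x) = x := fun x => by
    rw [← mul_assoc, ← EReal.coe_ennreal_mul, ← ENNReal.coe_mul, inv_mul_cancel₀ hl]
    simp
  unfold IsOptimalPotentials
  simp only [dual_smul ε hl]
  refine forall₂_congr fun f' g' => ⟨fun h => ?_, key⟩
  simpa only [hinv] using key (k := l⁻¹) h

end Scaling

section BoundedContinuous

variable {X Y : Type*} [TopologicalSpace X] [TopologicalSpace Y]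

/-- A continuous function with bounded absolute value. -/
structure IsBC (f : X → ℝ) : Prop where
  continuous : Continuous f
  bounded : ∃ C, ∀ x, |f x| ≤ C

theorem IsBC.const (c : ℝ) : IsBC fun _ : X => c := ⟨continuous_const, |c|, fun _ => le_rfl⟩

theorem IsBC.add {f g : X → ℝ} (hf : IsBC f) (hg : IsBC g) : IsBC fun x => f x + g x := by
  obtain ⟨C, hC⟩ := hf.bounded
  obtain ⟨D, hD⟩ := hg.bounded
  exact ⟨hf.continuous.add hg.continuous, C + D,
    fun x => (abs_add_le _ _).trans (add_le_add (hC x) (hD x))⟩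

theorem IsBC.mul {f g : X → ℝ} (hf : IsBC f) (hg : IsBC g) : IsBC fun x => f x * g x := by
  obtain ⟨C, hC⟩ := hf.bounded
  obtain ⟨D, hD⟩ := hg.bounded
  refine ⟨hf.continuous.mul hg.continuous, C * D, fun x => ?_⟩
  rw [abs_mul]
  exact mul_le_mul (hC x) (hD x) (abs_nonneg _) ((abs_nonneg _).trans (hC x))

theorem IsBC.neg {f : X → ℝ} (hf : IsBC f) : IsBC fun x => -f x :=
  ⟨hf.continuous.neg, hf.bounded.imp fun C hC x => by rw [abs_neg]; exact hC x⟩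

theorem IsBC.sub {f g : X → ℝ} (hf : IsBC f) (hg : IsBC g) : IsBC fun x => f x - g x := by
  simpa only [sub_eq_add_neg] using hf.add hg.neg

theorem IsBC.div_const {f : X → ℝ} (hf : IsBC f) (c : ℝ) : IsBC fun x => f x / c := by
  simpa only [div_eq_mul_inv] using hf.mul (IsBC.const c⁻¹)

theorem IsBC.comp {f : X → ℝ} (hf : IsBC f) {g : Y → X} (hg : Continuous g) :
    IsBC fun y => f (g y) :=
  ⟨hf.continuous.comp hg, hf.bounded.imp fun _ hC y => hC (g y)⟩

theorem IsBC.exp {f : X → ℝ} (hf : IsBC f) : IsBC fun x => Real.exp (f x) := by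
  obtain ⟨C, hC⟩ := hf.bounded
  refine ⟨hf.continuous.rexp, Real.exp C, fun x => ?_⟩
  rw [Real.abs_exp]
  exact Real.exp_le_exp.2 ((le_abs_self _).trans (hC x))

theorem IsBC.of_nonneg_of_le {f : X → ℝ} (hf : Continuous f) {C : ℝ} (h0 : ∀ x, 0 ≤ f x)
    (h1 : ∀ x, f x ≤ C) : IsBC f :=
  ⟨hf, C, fun x => by rw [abs_of_nonneg (h0 x)]; exact h1 x⟩

theorem IsBC.integrable [MeasurableSpace X] [OpensMeasurableSpace X] {f : X → ℝ} (hf : IsBC f)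
    (μ : Measure X) [IsFiniteMeasure μ] : Integrable f μ := by
  obtain ⟨C, hC⟩ := hf.bounded
  exact Integrable.of_bound hf.continuous.measurable.aestronglyMeasurable C
    (Eventually.of_forall hC)

/-- The associated bounded continuous function. -/
noncomputable def IsBC.toBCF {f : X → ℝ} (hf : IsBC f) : X →ᵇ ℝ :=
  BoundedContinuousFunction.ofNormedAddCommGroup f hf.continuous hf.bounded.choose
    hf.bounded.choose_spec

end BoundedContinuous

section Entropy

variable {X : Type*} [MeasurableSpace X]

theorem klFun_young {x : ℝ} (hx : 0 ≤ x) (h : ℝ) : h * x - Real.exp h + 1 ≤ klFun x := by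
  rw [klFun_apply]
  rcases hx.eq_or_lt with rfl | hx
  · simp [(Real.exp_pos h).le]
  · have h1 := Real.add_one_le_exp (h - Real.log x)
    rw [Real.exp_sub, Real.exp_log hx, le_div_iff₀ hx] at h1
    nlinarith

/-- The Legendre lower bound of the Kullback-Leibler divergence. -/
theorem integral_sub_integral_exp_le_klDiv {π ρ : Measure X} [IsFiniteMeasure π]
    [IsFiniteMeasure ρ] (hkl : klDiv π ρ ≠ ∞) {h : X → ℝ} (hm : Measurable h)
    {C : ℝ} (hC : ∀ x, |h x| ≤ C) :
    ∫ x, h x ∂π - ∫ x, Real.exp (h x) ∂ρ + ρ.real Set.univ ≤ (klDiv π ρ).toReal := by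
  obtain ⟨hac, hint⟩ := klDiv_ne_top_iff.1 hkl
  rw [toReal_klDiv_eq_integral_klFun hac, ← integral_rnDeriv_smul hac]
  have i1 : Integrable (fun x => (π.rnDeriv ρ x).toReal • h x) ρ :=
    (integrable_rnDeriv_smul_iff hac).2 (Integrable.of_bound hm.aestronglyMeasurable C
      (Eventually.of_forall hC))
  have i2 : Integrable (fun x => Real.exp (h x)) ρ :=
    Integrable.of_bound hm.exp.aestronglyMeasurable (Real.exp C) (Eventually.of_forall fun x => by
      rw [Real.norm_eq_abs, Real.abs_exp]
      exact Real.exp_le_exp.2 ((le_abs_self _).trans (hC x)))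
  have e1 : ρ.real Set.univ = ∫ _, (1 : ℝ) ∂ρ := by simp
  have i3 : Integrable (fun x => (π.rnDeriv ρ x).toReal • h x - Real.exp (h x)) ρ := i1.sub i2
  rw [e1, ← integral_sub i1 i2, ← integral_add i3 (integrable_const _)]
  refine integral_mono (i3.add (integrable_const _))
    ((integrable_klFun_rnDeriv_iff hac).2 hint) fun x => ?_
  have := klFun_young (x := (π.rnDeriv ρ x).toReal) ENNReal.toReal_nonneg (h x)
  simpa [mul_comm] using this

theorem klDiv_withDensity {ρ : Measure X} [IsFiniteMeasure ρ] {ξ : X → ℝ} (hm : Measurable ξ)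
    (h0 : ∀ x, 0 ≤ ξ x) {C : ℝ} (hC : ∀ x, ξ x ≤ C) :
    klDiv (ρ.withDensity fun x => ENNReal.ofReal (ξ x)) ρ
      = ENNReal.ofReal (∫ x, klFun (ξ x) ∂ρ) := by
  have : IsFiniteMeasure (ρ.withDensity fun x => ENNReal.ofReal (ξ x)) := by
    refine isFiniteMeasure_withDensity (ne_top_of_le_ne_top (b := ENNReal.ofReal C * ρ Set.univ)
      (ENNReal.mul_ne_top ENNReal.ofReal_ne_top (measure_ne_top _ _)) ?_)
    rw [← setLIntegral_const, Measure.restrict_univ]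
    exact lintegral_mono fun x => ENNReal.ofReal_le_ofReal (hC x)
  rw [klDiv_eq_lintegral_klFun_of_ac (withDensity_absolutelyContinuous _ _)]
  have e : ∫⁻ x, ENNReal.ofReal (klFun ((ρ.withDensity fun x =>
      ENNReal.ofReal (ξ x)).rnDeriv ρ x).toReal) ∂ρ = ∫⁻ x, ENNReal.ofReal (klFun (ξ x)) ∂ρ := by
    refine lintegral_congr_ae ?_
    filter_upwards [Measure.rnDeriv_withDensity ρ hm.ennreal_ofReal] with x hx
    rw [hx, ENNReal.toReal_ofReal (h0 x)]
  obtain ⟨D, hD⟩ := (isCompact_Icc (a := (0 : ℝ)) (b := C)).exists_bound_of_continuousOn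
    continuous_klFun.continuousOn
  rw [e, ofReal_integral_eq_lintegral_ofReal]
  · exact Integrable.of_bound (measurable_klFun.comp hm).aestronglyMeasurable D
      (Eventually.of_forall fun x => hD _ ⟨h0 x, hC x⟩)
  · exact Eventually.of_forall fun x => klFun_nonneg (h0 x)

end Entropy

noncomputable section

variable {d : ℕ} {Ω : Set (E d)}

/-- The kernel `exp ((c_∂(x) + c_∂(y) - c(x, y)) / ε)`. -/
def gibbs (ε : ℝ) (x y : Ω) : ℝ :=
  Real.exp ((costBdry x + costBdry y - cost (x : E d) (y : E d)) / ε)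

/-- The class of exponential potentials `u = exp (-(c_∂ - f) / ε)` considered here. -/
structure IsPot (u : Ω → ℝ) : Prop where
  continuous : Continuous u
  pos : ∀ x, 0 < u x
  le_one : ∀ x, u x ≤ 1
  bound : ∃ C, ∀ x, -Real.log (u x) ≤ C * costBdry x

/-- The dual objective in terms of the exponential potentials. -/
def dualVal (ε : ℝ) (a b : Measure Ω) (u v : Ω → ℝ) : ℝ :=
  (1 + ε / 2) * (a.real Set.univ + b.real Set.univ)
    + ε * (∫ x, Real.log (u x) / costBdry x ∂a + ∫ y, Real.log (v y) / costBdry y ∂b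
      - (∫ p, u p.1 * v p.2 * gibbs ε p.1 p.2 ∂(a.prod b)) / geomMass a b)

theorem gibbs_pos (ε : ℝ) (x y : Ω) : 0 < gibbs ε x y := Real.exp_pos _

theorem gibbs_comm (ε : ℝ) (x y : Ω) : gibbs ε x y = gibbs ε y x := by
  rw [gibbs, gibbs, cost_comm, add_comm (costBdry x)]

theorem isBC_costBdry (hΩb : Bornology.IsBounded Ω) : IsBC (costBdry : Ω → ℝ) := by
  obtain ⟨B, -, hB⟩ := exists_costBdry_le hΩb
  exact IsBC.of_nonneg_of_le continuous_costBdry costBdry_nonneg hB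

theorem isBC_cost (hΩb : Bornology.IsBounded Ω) :
    IsBC fun p : Ω × Ω => cost (p.1 : E d) (p.2 : E d) := by
  obtain ⟨B, hB⟩ := exists_cost_le hΩb
  exact IsBC.of_nonneg_of_le continuous_cost (fun p => cost_nonneg _ _) fun p => hB _ _

theorem isBC_gibbs (hΩb : Bornology.IsBounded Ω) (ε : ℝ) :
    IsBC fun p : Ω × Ω => gibbs ε p.1 p.2 :=
  ((((isBC_costBdry hΩb).comp continuous_fst).add
    ((isBC_costBdry hΩb).comp continuous_snd)).sub (isBC_cost hΩb)).div_const ε |>.exp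

namespace IsPot

variable {u : Ω → ℝ}

theorem isBC (h : IsPot u) : IsBC u :=
  IsBC.of_nonneg_of_le h.continuous (fun x => (h.pos x).le) h.le_one

theorem log_nonpos (h : IsPot u) (x : Ω) : Real.log (u x) ≤ 0 :=
  Real.log_nonpos (h.pos x).le (h.le_one x)

theorem continuous_log (h : IsPot u) : Continuous fun x => Real.log (u x) :=
  h.continuous.log fun x => (h.pos x).ne'

theorem isBC_log_div (h : IsPot u) (hpos : ∀ x : Ω, 0 < costBdry x) :
    IsBC fun x => Real.log (u x) / costBdry x := by
  obtain ⟨C, hC⟩ := h.bound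
  refine ⟨h.continuous_log.div continuous_costBdry fun x => (hpos x).ne', C, fun x => ?_⟩
  rw [abs_of_nonpos (div_nonpos_of_nonpos_of_nonneg (h.log_nonpos x) (hpos x).le), ← neg_div,
    div_le_iff₀ (hpos x)]
  exact hC x

theorem isBC_log (h : IsPot u) (hpos : ∀ x : Ω, 0 < costBdry x)
    (hΩb : Bornology.IsBounded Ω) : IsBC fun x => Real.log (u x) := by
  have := (h.isBC_log_div hpos).mul (isBC_costBdry hΩb)
  simpa only [div_mul_cancel₀ _ (hpos _).ne'] using this

end IsPot

theorem measurable_phi {z : Ω → ℝ} (hz : Measurable z) : Measurable fun x => phi x (z x) := by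
  unfold phi
  have hc : Measurable (costBdry : Ω → ℝ) := continuous_costBdry.measurable
  refine Measurable.ite ?_ ?_ measurable_const
  · exact (measurableSet_le measurable_const hz).inter
      (measurableSet_le hz (measurable_const.div hc))
  · exact (by fun_prop : Measurable fun x => |1 - costBdry x * z x|).ennreal_ofReal

theorem divPhi_ge (hpos : ∀ x : Ω, 0 < costBdry x) (hΩb : Bornology.IsBounded Ω) {ε : ℝ}
    (hε : 0 < ε) {μ ν : Measure Ω} [IsFiniteMeasure μ] [IsFiniteMeasure ν]
    (hfin : divPhi μ ν ≠ ∞) {u : Ω → ℝ} (hu : IsPot u) :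
    ν.real Set.univ + ε * ∫ x, Real.log (u x) / costBdry x ∂ν
      ≤ (divPhi μ ν).toReal + ∫ x, costBdry x ∂μ + ε * ∫ x, Real.log (u x) ∂μ := by
  unfold divPhi at hfin ⊢
  by_cases hac : μ ≪ ν
  swap
  · rw [if_neg hac] at hfin; exact absurd rfl hfin
  rw [if_pos hac] at hfin ⊢
  set z : Ω → ℝ := fun x => (μ.rnDeriv ν x).toReal with hz
  have hzm : Measurable z := (Measure.measurable_rnDeriv μ ν).ennreal_toReal
  have hmem : ∀ᵐ x ∂ν, z x ∈ Set.Icc 0 (1 / costBdry x) := by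
    filter_upwards [ae_lt_top (measurable_phi hzm) hfin] with x hx
    by_contra hcon
    rw [phi, if_neg hcon] at hx
    exact lt_irrefl _ hx
  have hle : ∀ᵐ x ∂ν, 0 ≤ 1 - costBdry x * z x := by
    filter_upwards [hmem] with x hx
    have := (le_div_iff₀ (hpos x)).1 hx.2
    linarith
  have e1 : ∫⁻ x, phi x (z x) ∂ν = ∫⁻ x, ENNReal.ofReal (1 - costBdry x * z x) ∂ν := by
    refine lintegral_congr_ae ?_
    filter_upwards [hmem, hle] with x hx hx'
    rw [phi, if_pos hx, abs_of_nonneg hx']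
  have hiz : Integrable z ν := Measure.integrable_toReal_rnDeriv
  have ir : ∀ {f : Ω → ℝ}, IsBC f → Integrable (fun x => f x * z x) ν := fun {f} hf => by
    have := (integrable_rnDeriv_smul_iff hac).2 (hf.integrable μ)
    simpa only [smul_eq_mul, mul_comm] using this
  have er : ∀ f : Ω → ℝ, ∫ x, f x ∂μ = ∫ x, f x * z x ∂ν := fun f => by
    rw [← integral_rnDeriv_smul hac]
    simp only [smul_eq_mul, mul_comm, hz]
  have ic := ir (isBC_costBdry hΩb)
  have il := ir (hu.isBC_log hpos hΩb)
  rw [e1, ← integral_eq_lintegral_of_nonneg_ae hle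
    (measurable_const.sub
      (continuous_costBdry.measurable.mul hzm)).aestronglyMeasurable, er, er,
    integral_sub (integrable_const _) ic]
  simp only [integral_const, smul_eq_mul, mul_one]
  have : ∫ x, Real.log (u x) / costBdry x ∂ν ≤ ∫ x, Real.log (u x) * z x ∂ν := by
    refine integral_mono_ae ((hu.isBC_log_div hpos).integrable ν) il ?_
    filter_upwards [hle] with x hx
    rw [div_le_iff₀ (hpos x)]
    nlinarith [hu.log_nonpos x]
  nlinarith

end

section Normalization

variable {X : Type*} [MeasurableSpace X]

theorem inv_mass_smul_prod_left {Y : Type*} [MeasurableSpace Y] (a : Measure X) (b : Measure Y)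
    [SFinite a] [SFinite b] :
    ((a Set.univ)⁻¹ • a).prod b = (a Set.univ)⁻¹ • a.prod b := Measure.prod_smul_left _

theorem inv_mass_smul_prod_right {Y : Type*} [MeasurableSpace Y] (a : Measure X) (b : Measure Y)
    [SFinite a] [SFinite b] :
    a.prod ((b Set.univ)⁻¹ • b) = (b Set.univ)⁻¹ • a.prod b := Measure.prod_smul_right _

theorem measureReal_univ_pos {a : Measure X} [IsFiniteMeasure a] (ha : a ≠ 0) :
    0 < a.real Set.univ := by
  exact ENNReal.toReal_pos (Measure.measure_univ_ne_zero.2 ha) (measure_ne_top _ _)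

theorem klDiv_inv_smul_ge {π ρ : Measure X} [IsFiniteMeasure π] [IsFiniteMeasure ρ] {c : ℝ≥0∞}
    (hc0 : c ≠ 0) (hc : c ≠ ∞) (hkl : klDiv π (c⁻¹ • ρ) ≠ ∞) {h : X → ℝ} (hm : Measurable h)
    {C : ℝ} (hC : ∀ x, |h x| ≤ C) {m : ℝ} (hmpos : 0 < m) :
    ∫ x, h x ∂π + Real.log (c.toReal / m) * π.real Set.univ - (∫ x, Real.exp (h x) ∂ρ) / m
      + ρ.real Set.univ / c.toReal ≤ (klDiv π (c⁻¹ • ρ)).toReal := by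
  have hcr : 0 < c.toReal := ENNReal.toReal_pos hc0 hc
  have : IsFiniteMeasure (c⁻¹ • ρ) := ⟨by
    rw [Measure.smul_apply, smul_eq_mul]
    exact ENNReal.mul_lt_top (by simpa [pos_iff_ne_zero] using hc0) (measure_lt_top _ _)⟩
  have key := integral_sub_integral_exp_le_klDiv hkl (h := fun x => h x + Real.log (c.toReal / m))
    (hm.add_const _) (C := C + |Real.log (c.toReal / m)|)
    fun x => (abs_add_le _ _).trans (add_le_add_left (hC x) _)
  have ih : Integrable h π := Integrable.of_bound hm.aestronglyMeasurable C
    (Eventually.of_forall hC)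
  have e1 : ∫ x, Real.exp (h x + Real.log (c.toReal / m)) ∂(c⁻¹ • ρ)
      = (∫ x, Real.exp (h x) ∂ρ) / m := by
    rw [integral_smul_measure]
    simp only [Real.exp_add, Real.exp_log (div_pos hcr hmpos)]
    rw [integral_mul_const, ENNReal.toReal_inv, smul_eq_mul]
    field_simp
  have e2 : (c⁻¹ • ρ).real Set.univ = ρ.real Set.univ / c.toReal := by
    rw [Measure.real, Measure.smul_apply, smul_eq_mul, ENNReal.toReal_mul, ENNReal.toReal_inv,
      Measure.real, inv_mul_eq_div]
  rw [e1, e2, integral_add ih (integrable_const _), integral_const, smul_eq_mul] at key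
  linarith

theorem klDiv_withDensity_inv_smul {ρ : Measure X} [IsFiniteMeasure ρ] {c : ℝ≥0∞}
    (hc0 : c ≠ 0) (hc : c ≠ ∞) {ξ : X → ℝ} (hm : Measurable ξ) (h0 : ∀ x, 0 < ξ x)
    {C : ℝ} (hC : ∀ x, ξ x ≤ C) (hlog : Integrable (fun x => ξ x * Real.log (ξ x)) ρ) :
    klDiv (ρ.withDensity fun x => ENNReal.ofReal (ξ x)) (c⁻¹ • ρ)
        = ENNReal.ofReal (∫ x, ξ x * Real.log (ξ x) ∂ρ + (Real.log c.toReal - 1) * ∫ x, ξ x ∂ρ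
          + ρ.real Set.univ / c.toReal) ∧
      0 ≤ ∫ x, ξ x * Real.log (ξ x) ∂ρ + (Real.log c.toReal - 1) * ∫ x, ξ x ∂ρ
          + ρ.real Set.univ / c.toReal := by
  have hcr : 0 < c.toReal := ENNReal.toReal_pos hc0 hc
  have : IsFiniteMeasure (c⁻¹ • ρ) := ⟨by
    rw [Measure.smul_apply, smul_eq_mul]
    exact ENNReal.mul_lt_top (by simpa [pos_iff_ne_zero] using hc0) (measure_lt_top _ _)⟩
  have e1 : ρ.withDensity (fun x => ENNReal.ofReal (ξ x))
      = (c⁻¹ • ρ).withDensity fun x => ENNReal.ofReal (c.toReal * ξ x) := by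
    rw [withDensity_smul_measure, ← withDensity_smul]
    · congr 1
      funext x
      rw [Pi.smul_apply, ENNReal.ofReal_mul hcr.le, ENNReal.ofReal_toReal hc, smul_eq_mul,
        ← mul_assoc, ENNReal.inv_mul_cancel hc0 hc, one_mul]
    · exact (hm.const_mul _).ennreal_ofReal
  have e2 : ∫ x, klFun (c.toReal * ξ x) ∂(c⁻¹ • ρ)
      = ∫ x, ξ x * Real.log (ξ x) ∂ρ + (Real.log c.toReal - 1) * ∫ x, ξ x ∂ρ
          + ρ.real Set.univ / c.toReal := by
    have iξ : Integrable ξ ρ := Integrable.of_bound hm.aestronglyMeasurable C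
      (Eventually.of_forall fun x => by rw [Real.norm_eq_abs, abs_of_pos (h0 x)]; exact hC x)
    have e3 : ∀ x, klFun (c.toReal * ξ x) = c.toReal *
        (ξ x * Real.log (ξ x) + (Real.log c.toReal - 1) * ξ x + 1 / c.toReal) := fun x => by
      rw [klFun_apply, Real.log_mul hcr.ne' (h0 x).ne']
      field_simp
      ring
    have i1 : Integrable (fun x => ξ x * Real.log (ξ x) + (Real.log c.toReal - 1) * ξ x) ρ :=
      hlog.add (iξ.const_mul _)
    simp only [e3]
    rw [integral_smul_measure, integral_const_mul, integral_add i1 (integrable_const _),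
      integral_add hlog (iξ.const_mul _), integral_const_mul,
      integral_const, ENNReal.toReal_inv, smul_eq_mul, smul_eq_mul]
    field_simp
  rw [e1, klDiv_withDensity (hm.const_mul _) (fun x => (mul_pos hcr (h0 x)).le)
    (C := c.toReal * C) (fun x => mul_le_mul_of_nonneg_left (hC x) hcr.le), e2]
  exact ⟨rfl, e2 ▸ integral_nonneg fun x => klFun_nonneg (mul_pos hcr (h0 x)).le⟩

end Normalization

noncomputable section

variable {d : ℕ} {Ω : Set (E d)}

theorem geomMass_pos {a b : Measure Ω} [IsFiniteMeasure a] [IsFiniteMeasure b] (ha : a ≠ 0)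
    (hb : b ≠ 0) : 0 < geomMass a b :=
  Real.sqrt_pos.2 (mul_pos (measureReal_univ_pos ha) (measureReal_univ_pos hb))

theorem log_add_log_eq_two_mul_log_geomMass {a b : Measure Ω} [IsFiniteMeasure a]
    [IsFiniteMeasure b] (ha : a ≠ 0) (hb : b ≠ 0) :
    Real.log (a.real Set.univ) + Real.log (b.real Set.univ) = 2 * Real.log (geomMass a b) := by
  have h1 := measureReal_univ_pos ha
  have h2 := measureReal_univ_pos hb
  rw [geomMass, Real.log_sqrt (mul_pos h1 h2).le, Real.log_mul h1.ne' h2.ne']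
  ring

theorem measureReal_prod_univ (a b : Measure Ω) [IsFiniteMeasure a] [IsFiniteMeasure b] :
    (a.prod b).real Set.univ = a.real Set.univ * b.real Set.univ := by
  rw [← Set.univ_prod_univ, measureReal_prod_prod]

theorem le_toReal_reg {a b : Measure Ω} [IsFiniteMeasure a] [IsFiniteMeasure b] (ha : a ≠ 0)
    (hb : b ≠ 0) {π : Measure (Ω × Ω)} [IsFiniteMeasure π] (hfin : reg π a b ≠ ∞)
    {h : Ω × Ω → ℝ} (hh : IsBC h) :
    ∫ p, h p ∂π - (∫ p, Real.exp (h p) ∂(a.prod b)) / geomMass a b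
      + (a.real Set.univ + b.real Set.univ) / 2 ≤ (reg π a b).toReal := by
  obtain ⟨C, hC⟩ := hh.bounded
  have hma := measureReal_univ_pos ha
  have hmb := measureReal_univ_pos hb
  have hg := geomMass_pos ha hb
  unfold reg at hfin ⊢
  rw [inv_mass_smul_prod_left, inv_mass_smul_prod_right] at hfin ⊢
  have hsum : klDiv π ((a Set.univ)⁻¹ • a.prod b) + klDiv π ((b Set.univ)⁻¹ • a.prod b) ≠ ∞ := by
    intro h
    rw [h] at hfin
    exact hfin (ENNReal.top_div_of_ne_top (by norm_num))
  obtain ⟨f1, f2⟩ := ENNReal.add_ne_top.1 hsum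
  have k1 := klDiv_inv_smul_ge (Measure.measure_univ_ne_zero.2 ha) (measure_ne_top _ _) f1
    hh.continuous.measurable hC hg
  have k2 := klDiv_inv_smul_ge (Measure.measure_univ_ne_zero.2 hb) (measure_ne_top _ _) f2
    hh.continuous.measurable hC hg
  rw [ENNReal.toReal_div, ENNReal.toReal_add f1 f2]
  change _ + Real.log (a.real Set.univ / _) * _ - _ + _ / a.real Set.univ ≤ _ at k1
  change _ + Real.log (b.real Set.univ / _) * _ - _ + _ / b.real Set.univ ≤ _ at k2
  rw [measureReal_prod_univ, mul_div_cancel_left₀ _ hma.ne', Real.log_div hma.ne' hg.ne'] at k1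
  rw [measureReal_prod_univ, mul_div_cancel_right₀ _ hmb.ne', Real.log_div hmb.ne' hg.ne'] at k2
  have e : Real.log (b.real Set.univ)
      = 2 * Real.log (geomMass a b) - Real.log (a.real Set.univ) := by
    linarith [log_add_log_eq_two_mul_log_geomMass ha hb]
  rw [e] at k2
  rw [ENNReal.toReal_ofNat, le_div_iff₀ two_pos]
  nlinarith

/-- Weak duality. -/
theorem dualVal_le_primal (hpos : ∀ x : Ω, 0 < costBdry x) (hΩb : Bornology.IsBounded Ω) {ε : ℝ}
    (hε : 0 < ε) {α β : Measure Ω} [IsFiniteMeasure (hat α)] [IsFiniteMeasure (hat β)]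
    (hα : hat α ≠ 0) (hβ : hat β ≠ 0) {u v : Ω → ℝ} (hu : IsPot u) (hv : IsPot v)
    (π : FiniteMeasure (Ω × Ω)) :
    ENNReal.ofReal (dualVal ε (hat α) (hat β) u v) ≤ primal ε α β π := by
  by_cases hfin : primal ε α β π = ∞
  · rw [hfin]; exact le_top
  rw [ENNReal.ofReal_le_iff_le_toReal hfin]
  have hε' : ENNReal.ofReal ε ≠ 0 := by simpa using hε
  unfold primal at hfin ⊢
  obtain ⟨hfin', f4⟩ := ENNReal.add_ne_top.1 hfin
  obtain ⟨hfin'', f3⟩ := ENNReal.add_ne_top.1 hfin'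
  obtain ⟨f1, f2⟩ := ENNReal.add_ne_top.1 hfin''
  have f5 : reg (π : Measure (Ω × Ω)) (hat α) (hat β) ≠ ∞ := by
    intro h
    rw [h, ENNReal.mul_top hε'] at f4
    exact f4 rfl
  rw [ENNReal.toReal_add hfin' f4, ENNReal.toReal_add hfin'' f3, ENNReal.toReal_add f1 f2,
    ENNReal.toReal_mul, ENNReal.toReal_ofReal hε.le, ← integral_eq_lintegral_of_nonneg_ae
      (Eventually.of_forall fun p => cost_nonneg _ _) continuous_cost.aestronglyMeasurable]
  have d1 := divPhi_ge hpos hΩb hε f2 hu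
  have d2 := divPhi_ge hpos hΩb hε f3 hv
  have bu := (hu.isBC_log hpos hΩb).comp (continuous_fst : Continuous (Prod.fst : Ω × Ω → Ω))
  have bv := (hv.isBC_log hpos hΩb).comp (continuous_snd : Continuous (Prod.snd : Ω × Ω → Ω))
  have b1 := (isBC_costBdry hΩb).comp (continuous_fst : Continuous (Prod.fst : Ω × Ω → Ω))
  have b2 := (isBC_costBdry hΩb).comp (continuous_snd : Continuous (Prod.snd : Ω × Ω → Ω))
  have bc := isBC_cost hΩb
  have d3 := le_toReal_reg hα hβ f5 ((bu.add bv).add (((b1.add b2).sub bc).div_const ε))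
  have e1 : ∀ p : Ω × Ω, Real.exp (Real.log (u p.1) + Real.log (v p.2)
      + (costBdry p.1 + costBdry p.2 - cost (p.1 : E d) (p.2 : E d)) / ε)
      = u p.1 * v p.2 * gibbs ε p.1 p.2 := fun p => by
    rw [Real.exp_add, Real.exp_add, Real.exp_log (hu.pos _), Real.exp_log (hv.pos _), gibbs]
  simp only [e1] at d3
  have m1 : ∀ {f : Ω → ℝ}, Continuous f →
      ∫ x, f x ∂((π : Measure (Ω × Ω)).map Prod.fst) = ∫ p, f p.1 ∂(π : Measure (Ω × Ω)) :=
    fun hf => integral_map measurable_fst.aemeasurable hf.aestronglyMeasurable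
  have m2 : ∀ {f : Ω → ℝ}, Continuous f →
      ∫ x, f x ∂((π : Measure (Ω × Ω)).map Prod.snd) = ∫ p, f p.2 ∂(π : Measure (Ω × Ω)) :=
    fun hf => integral_map measurable_snd.aemeasurable hf.aestronglyMeasurable
  rw [m1 continuous_costBdry, m1 hu.continuous_log] at d1
  rw [m2 continuous_costBdry, m2 hv.continuous_log] at d2
  have I : ∀ {f : Ω × Ω → ℝ}, IsBC f → Integrable f (π : Measure (Ω × Ω)) := fun h =>
    h.integrable _
  rw [integral_add (I (bu.add bv)) (I (((b1.add b2).sub bc).div_const ε)), integral_add (I bu) (I bv),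
    integral_div, integral_sub (I (b1.add b2)) (I bc), integral_add (I b1) (I b2)] at d3
  have d4 := mul_le_mul_of_nonneg_left d3 hε.le
  rw [mul_add, mul_sub, mul_add, mul_div_cancel₀ _ hε.ne', mul_add] at d4
  unfold dualVal
  linarith

theorem dualVal_le_FG (hpos : ∀ x : Ω, 0 < costBdry x) (hΩb : Bornology.IsBounded Ω) {ε : ℝ}
    (hε : 0 < ε) {α β : Measure Ω} (hα : FinPers α) (hβ : FinPers β) (hα0 : α ≠ 0) (hβ0 : β ≠ 0)
    {u v : Ω → ℝ} (hu : IsPot u) (hv : IsPot v) :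
    dualVal ε (hat α) (hat β) u v ≤ (FG ε α β).toReal := by
  have := hα.isFiniteMeasure_hat
  have := hβ.isFiniteMeasure_hat
  rw [← ENNReal.ofReal_le_iff_le_toReal (FG_ne_top ε hα hβ), FG, if_neg hα0, if_neg hβ0]
  exact le_iInf fun π => dualVal_le_primal hpos hΩb hε (mt (hat_eq_zero_iff hpos).1 hα0)
    (mt (hat_eq_zero_iff hpos).1 hβ0) hu hv π

theorem divPhi_withDensity {ν : Measure Ω} [IsFiniteMeasure ν] (hpos : ∀ x : Ω, 0 < costBdry x)
    {w : Ω → ℝ} (hm : Measurable w) (h0 : ∀ x, 0 ≤ w x) (h1 : ∀ x, costBdry x * w x ≤ 1) :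
    divPhi (ν.withDensity fun x => ENNReal.ofReal (w x)) ν
        = ENNReal.ofReal (ν.real Set.univ - ∫ x, costBdry x * w x ∂ν) ∧
      0 ≤ ν.real Set.univ - ∫ x, costBdry x * w x ∂ν := by
  have hcm : Measurable fun x : Ω => costBdry x * w x := continuous_costBdry.measurable.mul hm
  have hi : Integrable (fun x => costBdry x * w x) ν :=
    Integrable.of_bound hcm.aestronglyMeasurable 1 (Eventually.of_forall fun x => by
      rw [Real.norm_eq_abs, abs_of_nonneg (mul_nonneg (hpos x).le (h0 x))]; exact h1 x)
  have e0 : ∫ x, (1 - costBdry x * w x) ∂ν = ν.real Set.univ - ∫ x, costBdry x * w x ∂ν := by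
    rw [integral_sub (integrable_const _) hi]; simp
  have hi' : Integrable (fun x => 1 - costBdry x * w x) ν := (integrable_const _).sub hi
  rw [← e0]
  refine ⟨?_, integral_nonneg fun x => sub_nonneg.2 (h1 x)⟩
  rw [divPhi, if_pos (withDensity_absolutelyContinuous _ _), ofReal_integral_eq_lintegral_ofReal
    hi' (Eventually.of_forall fun x => sub_nonneg.2 (h1 x))]
  refine lintegral_congr_ae ?_
  filter_upwards [Measure.rnDeriv_withDensity ν hm.ennreal_ofReal] with x hx
  rw [hx, ENNReal.toReal_ofReal (h0 x), phi, if_pos ⟨h0 x, (le_div_iff₀ (hpos x)).2 (by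
    rw [mul_comm]; exact h1 x)⟩, abs_of_nonneg (sub_nonneg.2 (h1 x))]

end

noncomputable section

variable {d : ℕ} {Ω : Set (E d)}

theorem map_fst_withDensity_prod {a b : Measure Ω} [IsFiniteMeasure a] [IsFiniteMeasure b]
    {ξ : Ω × Ω → ℝ} (hξ : IsBC ξ) (h0 : ∀ p, 0 < ξ p) :
    ((a.prod b).withDensity fun p => ENNReal.ofReal (ξ p)).map Prod.fst
      = a.withDensity fun x => ENNReal.ofReal (∫ y, ξ (x, y) ∂b) := by
  have hm : Measurable fun p => ENNReal.ofReal (ξ p) := hξ.continuous.measurable.ennreal_ofReal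
  ext s hs
  rw [Measure.map_apply measurable_fst hs, withDensity_apply _ (measurable_fst hs),
    withDensity_apply _ hs, ← Set.prod_univ, setLIntegral_prod _ hm.aemeasurable]
  refine lintegral_congr fun x => ?_
  rw [Measure.restrict_univ, ofReal_integral_eq_lintegral_ofReal
    ((hξ.comp (by fun_prop : Continuous fun y : Ω => (x, y))).integrable b)
    (Eventually.of_forall fun y => (h0 _).le)]

theorem map_snd_withDensity_prod {a b : Measure Ω} [IsFiniteMeasure a] [IsFiniteMeasure b]
    {ξ : Ω × Ω → ℝ} (hξ : IsBC ξ) (h0 : ∀ p, 0 < ξ p) :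
    ((a.prod b).withDensity fun p => ENNReal.ofReal (ξ p)).map Prod.snd
      = b.withDensity fun y => ENNReal.ofReal (∫ x, ξ (x, y) ∂a) := by
  have hm : Measurable fun p => ENNReal.ofReal (ξ p) := hξ.continuous.measurable.ennreal_ofReal
  ext s hs
  rw [Measure.map_apply measurable_snd hs, withDensity_apply _ (measurable_snd hs),
    withDensity_apply _ hs, ← Set.univ_prod, setLIntegral_prod_symm _ hm.aemeasurable]
  refine lintegral_congr fun y => ?_
  rw [Measure.restrict_univ, ofReal_integral_eq_lintegral_ofReal
    ((hξ.comp (by fun_prop : Continuous fun x : Ω => (x, y))).integrable a)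
    (Eventually.of_forall fun y => (h0 _).le)]

theorem divPhi_map_fst (hpos : ∀ x : Ω, 0 < costBdry x) (hΩb : Bornology.IsBounded Ω)
    {a b : Measure Ω} [IsFiniteMeasure a] [IsFiniteMeasure b]
    {ξ : Ω × Ω → ℝ} (hξ : IsBC ξ) (h0 : ∀ p, 0 < ξ p)
    (h1 : ∀ x, costBdry x * ∫ y, ξ (x, y) ∂b ≤ 1) :
    divPhi (((a.prod b).withDensity fun p => ENNReal.ofReal (ξ p)).map Prod.fst) a
        = ENNReal.ofReal (a.real Set.univ - ∫ p, costBdry p.1 * ξ p ∂(a.prod b)) ∧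
      0 ≤ a.real Set.univ - ∫ p, costBdry p.1 * ξ p ∂(a.prod b) := by
  have e : ∫ p, costBdry p.1 * ξ p ∂(a.prod b) = ∫ x, costBdry x * ∫ y, ξ (x, y) ∂b ∂a := by
    rw [integral_prod _ ((((isBC_costBdry hΩb).comp continuous_fst).mul hξ).integrable _)]
    simp only [integral_const_mul]
  rw [map_fst_withDensity_prod hξ h0, e]
  exact divPhi_withDensity hpos
    (hξ.continuous.measurable.stronglyMeasurable.integral_prod_right').measurable
    (fun x => integral_nonneg fun y => (h0 _).le) h1

theorem divPhi_map_snd (hpos : ∀ x : Ω, 0 < costBdry x) (hΩb : Bornology.IsBounded Ω)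
    {a b : Measure Ω} [IsFiniteMeasure a] [IsFiniteMeasure b]
    {ξ : Ω × Ω → ℝ} (hξ : IsBC ξ) (h0 : ∀ p, 0 < ξ p)
    (h1 : ∀ y, costBdry y * ∫ x, ξ (x, y) ∂a ≤ 1) :
    divPhi (((a.prod b).withDensity fun p => ENNReal.ofReal (ξ p)).map Prod.snd) b
        = ENNReal.ofReal (b.real Set.univ - ∫ p, costBdry p.2 * ξ p ∂(a.prod b)) ∧
      0 ≤ b.real Set.univ - ∫ p, costBdry p.2 * ξ p ∂(a.prod b) := by
  have e : ∫ p, costBdry p.2 * ξ p ∂(a.prod b) = ∫ y, costBdry y * ∫ x, ξ (x, y) ∂a ∂b := by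
    rw [integral_prod_symm _ ((((isBC_costBdry hΩb).comp continuous_snd).mul hξ).integrable _)]
    simp only [integral_const_mul]
  rw [map_snd_withDensity_prod hξ h0, e]
  exact divPhi_withDensity hpos
    (hξ.continuous.measurable.stronglyMeasurable.integral_prod_left').measurable
    (fun x => integral_nonneg fun y => (h0 _).le) h1

theorem isFiniteMeasure_withDensity_isBC {X : Type*} [TopologicalSpace X] [MeasurableSpace X]
    [OpensMeasurableSpace X] {ρ : Measure X} [IsFiniteMeasure ρ] {ξ : X → ℝ} (hξ : IsBC ξ) :
    IsFiniteMeasure (ρ.withDensity fun p => ENNReal.ofReal (ξ p)) :=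
  isFiniteMeasure_withDensity_ofReal (hξ.integrable ρ).2

/-- The value of the primal objective at the plan with density `ξ`. -/
theorem primal_withDensity_le (hpos : ∀ x : Ω, 0 < costBdry x) (hΩb : Bornology.IsBounded Ω)
    {ε : ℝ} (hε : 0 < ε) {α β : Measure Ω} [IsFiniteMeasure (hat α)] [IsFiniteMeasure (hat β)]
    (hα : hat α ≠ 0) (hβ : hat β ≠ 0) {ξ : Ω × Ω → ℝ} (hξ : IsBC ξ) (h0 : ∀ p, 0 < ξ p)
    (hlog : IsBC fun p => Real.log (ξ p))
    (h1 : ∀ x, costBdry x * ∫ y, ξ (x, y) ∂(hat β) ≤ 1)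
    (h2 : ∀ y, costBdry y * ∫ x, ξ (x, y) ∂(hat α) ≤ 1) :
    (⨅ π, primal ε α β π).toReal ≤
      ((1 + ε / 2) * ((hat α).real Set.univ + (hat β).real Set.univ)
        + ∫ p, ξ p * (cost (p.1 : E d) (p.2 : E d) - costBdry p.1 - costBdry p.2
          + ε * (Real.log (ξ p) + Real.log (geomMass (hat α) (hat β)) - 1))
            ∂((hat α).prod (hat β))) := by
  set a := hat α with hadef
  set b := hat β with hbdef
  have hfin := isFiniteMeasure_withDensity_isBC (ρ := a.prod b) hξ
  have hma := measureReal_univ_pos hα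
  have hmb := measureReal_univ_pos hβ
  obtain ⟨C, hC⟩ := hξ.bounded
  have bc := isBC_cost hΩb
  have b1 := (isBC_costBdry hΩb).comp (continuous_fst : Continuous (Prod.fst : Ω × Ω → Ω))
  have b2 := (isBC_costBdry hΩb).comp (continuous_snd : Continuous (Prod.snd : Ω × Ω → Ω))
  have I : ∀ {f : Ω × Ω → ℝ}, IsBC f → Integrable f (a.prod b) := fun h => h.integrable _
  obtain ⟨d1, d1'⟩ := divPhi_map_fst (a := a) (b := b) hpos hΩb hξ h0 h1
  obtain ⟨d2, d2'⟩ := divPhi_map_snd (a := a) (b := b) hpos hΩb hξ h0 h2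
  have hCle : ∀ p, ξ p ≤ C := fun p => (le_abs_self _).trans (hC p)
  obtain ⟨k1, k1'⟩ := klDiv_withDensity_inv_smul (ρ := a.prod b)
    (Measure.measure_univ_ne_zero.2 hα) (measure_ne_top _ _) hξ.continuous.measurable h0 hCle
    (I (hξ.mul hlog))
  obtain ⟨k2, k2'⟩ := klDiv_withDensity_inv_smul (ρ := a.prod b)
    (Measure.measure_univ_ne_zero.2 hβ) (measure_ne_top _ _) hξ.continuous.measurable h0 hCle
    (I (hξ.mul hlog))
  have hc : ∫⁻ p, ENNReal.ofReal (cost (p.1 : E d) (p.2 : E d))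
      ∂((a.prod b).withDensity fun p => ENNReal.ofReal (ξ p))
      = ENNReal.ofReal (∫ p, ξ p * cost (p.1 : E d) (p.2 : E d) ∂(a.prod b)) := by
    rw [lintegral_withDensity_eq_lintegral_mul _ hξ.continuous.measurable.ennreal_ofReal
      continuous_cost.measurable.ennreal_ofReal, ofReal_integral_eq_lintegral_ofReal
      (I (hξ.mul bc)) (Eventually.of_forall fun p => mul_nonneg (h0 p).le (cost_nonneg _ _))]
    refine lintegral_congr fun p => ?_
    rw [Pi.mul_apply, ENNReal.ofReal_mul (h0 p).le]
  have hc' : 0 ≤ ∫ p, ξ p * cost (p.1 : E d) (p.2 : E d) ∂(a.prod b) :=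
    integral_nonneg fun p => mul_nonneg (h0 p).le (cost_nonneg _ _)
  have two : ∀ r : ℝ, ENNReal.ofReal r / 2 = ENNReal.ofReal (r / 2) := fun r => by
    rw [ENNReal.ofReal_div_of_pos two_pos, ENNReal.ofReal_ofNat]
  have hS := add_nonneg (add_nonneg (add_nonneg hc' d1') d2')
    (mul_nonneg hε.le (div_nonneg (add_nonneg k1' k2') two_pos.le))
  refine (ENNReal.toReal_le_of_le_ofReal hS
    ((iInf_le _ ⟨(a.prod b).withDensity fun p => ENNReal.ofReal (ξ p), hfin⟩).trans_eq ?_)).trans_eq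
    ?_
  · simp only [primal, FiniteMeasure.toMeasure_mk]
    rw [← hadef, ← hbdef]
    rw [reg, inv_mass_smul_prod_left, inv_mass_smul_prod_right, hc, d1, d2, k1, k2,
    ← ENNReal.ofReal_add k1' k2', two,
    ← ENNReal.ofReal_mul hε.le, ← ENNReal.ofReal_add hc' d1',
    ← ENNReal.ofReal_add (add_nonneg hc' d1') d2', ← ENNReal.ofReal_add
      (add_nonneg (add_nonneg hc' d1') d2')
      (mul_nonneg hε.le (div_nonneg (add_nonneg k1' k2') two_pos.le))]
  have e : ∀ p : Ω × Ω, ξ p * (cost (p.1 : E d) (p.2 : E d) - costBdry p.1 - costBdry p.2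
        + ε * (Real.log (ξ p) + Real.log (geomMass a b) - 1))
      = ξ p * cost (p.1 : E d) (p.2 : E d) - costBdry p.1 * ξ p - costBdry p.2 * ξ p
        + ε * (ξ p * Real.log (ξ p)) + ε * (Real.log (geomMass a b) - 1) * ξ p := fun p => by ring
  simp only [e]
  rw [integral_add (I (((((hξ.mul bc).sub (b1.mul hξ)).sub (b2.mul hξ)).add
      ((IsBC.const ε).mul (hξ.mul hlog)))))
      (I ((IsBC.const (ε * (Real.log (geomMass a b) - 1))).mul hξ)),
    integral_add (I (((hξ.mul bc).sub (b1.mul hξ)).sub (b2.mul hξ)))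
      (I ((IsBC.const ε).mul (hξ.mul hlog))),
    integral_sub (I ((hξ.mul bc).sub (b1.mul hξ))) (I (b2.mul hξ)),
    integral_sub (I (hξ.mul bc)) (I (b1.mul hξ)), integral_const_mul, integral_const_mul]
  change _ + ε * ((_ + (Real.log (a.real Set.univ) - 1) * _ + _ / a.real Set.univ
    + (_ + (Real.log (b.real Set.univ) - 1) * _ + _ / b.real Set.univ)) / 2) = _
  have hl : Real.log (b.real Set.univ)
      = 2 * Real.log (geomMass a b) - Real.log (a.real Set.univ) := by
    linarith [log_add_log_eq_two_mul_log_geomMass hα hβ]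
  rw [hl, measureReal_prod_univ, mul_div_cancel_left₀ _ hma.ne', mul_div_cancel_right₀ _ hmb.ne']
  ring

/-- The value of the primal objective at the plan with density `s u v gibbs / m_g`. -/
def gibbsVal (ε : ℝ) (a b : Measure Ω) (u v : Ω → ℝ) (s : ℝ) : ℝ :=
  (1 + ε / 2) * (a.real Set.univ + b.real Set.univ)
    + ε * (s / geomMass a b * ∫ p, u p.1 * v p.2 * gibbs ε p.1 p.2
      * (Real.log s + Real.log (u p.1) + Real.log (v p.2) - 1) ∂(a.prod b))

/-- The upper bound of `FG` given by feasible plans in Gibbs form. -/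
theorem FG_le_of_feasible (hpos : ∀ x : Ω, 0 < costBdry x) (hΩb : Bornology.IsBounded Ω)
    {ε : ℝ} (hε : 0 < ε) {α β : Measure Ω} (hα : FinPers α) (hβ : FinPers β)
    (hα0 : α ≠ 0) (hβ0 : β ≠ 0) {u v : Ω → ℝ} (hu : IsPot u) (hv : IsPot v)
    {s : ℝ} (hs : 0 < s)
    (h1 : ∀ x, s * (costBdry x * u x *
      ((∫ y, v y * gibbs ε x y ∂(hat β)) / geomMass (hat α) (hat β))) ≤ 1)
    (h2 : ∀ y, s * (costBdry y * v y *
      ((∫ x, u x * gibbs ε y x ∂(hat α)) / geomMass (hat α) (hat β))) ≤ 1) :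
    (FG ε α β).toReal ≤ gibbsVal ε (hat α) (hat β) u v s := by
  have := hα.isFiniteMeasure_hat
  have := hβ.isFiniteMeasure_hat
  have hα' := mt (hat_eq_zero_iff hpos).1 hα0
  have hβ' := mt (hat_eq_zero_iff hpos).1 hβ0
  have hg := geomMass_pos hα' hβ'
  set g := geomMass (hat α) (hat β)
  rw [FG, if_neg hα0, if_neg hβ0]
  have hlogξ : ∀ p : Ω × Ω, Real.log (s / g * (u p.1 * v p.2 * gibbs ε p.1 p.2))
      = Real.log s - Real.log g + (Real.log (u p.1) + Real.log (v p.2)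
        + (costBdry p.1 + costBdry p.2 - cost (p.1 : E d) (p.2 : E d)) / ε) := fun p => by
    rw [Real.log_mul (div_pos hs hg).ne' (mul_pos (mul_pos (hu.pos _) (hv.pos _))
      (gibbs_pos _ _ _)).ne', Real.log_mul (mul_pos (hu.pos _) (hv.pos _)).ne'
      (gibbs_pos _ _ _).ne', Real.log_mul (hu.pos _).ne' (hv.pos _).ne',
      Real.log_div hs.ne' hg.ne', gibbs, Real.log_exp]
  have bu := (hu.isBC_log hpos hΩb).comp (continuous_fst : Continuous (Prod.fst : Ω × Ω → Ω))
  have bv := (hv.isBC_log hpos hΩb).comp (continuous_snd : Continuous (Prod.snd : Ω × Ω → Ω))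
  have b1 := (isBC_costBdry hΩb).comp (continuous_fst : Continuous (Prod.fst : Ω × Ω → Ω))
  have b2 := (isBC_costBdry hΩb).comp (continuous_snd : Continuous (Prod.snd : Ω × Ω → Ω))
  have key := primal_withDensity_le hpos hΩb hε hα' hβ'
    (ξ := fun p => s / g * (u p.1 * v p.2 * gibbs ε p.1 p.2))
    ((IsBC.const (s / g)).mul (((hu.isBC.comp continuous_fst).mul
      (hv.isBC.comp continuous_snd)).mul (isBC_gibbs hΩb ε)))
    (fun p => mul_pos (div_pos hs hg) (mul_pos (mul_pos (hu.pos _) (hv.pos _)) (gibbs_pos _ _ _)))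
    (by
      simp only [hlogξ]
      exact (IsBC.const _).add ((bu.add bv).add (((b1.add b2).sub (isBC_cost hΩb)).div_const ε)))
    (fun x => by
      refine le_of_eq_of_le ?_ (h1 x)
      simp only [mul_assoc, integral_const_mul]
      ring)
    (fun y => by
      refine le_of_eq_of_le ?_ (h2 y)
      have : ∀ x, s / g * (u x * v y * gibbs ε x y) = s / g * v y * (u x * gibbs ε y x) :=
        fun x => by rw [gibbs_comm]; ring
      simp only [this, integral_const_mul]
      ring)
  refine key.trans_eq ?_
  unfold gibbsVal
  change _ = _ + ε * (s / g * _)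
  congr 1
  rw [mul_left_comm, ← mul_assoc, ← integral_const_mul]
  refine integral_congr_ae (Eventually.of_forall fun p => ?_)
  simp only [hlogξ]
  change _ * (_ + ε * (_ + Real.log g - 1)) = _
  field_simp
  ring

end

noncomputable section

variable {d : ℕ} {Ω : Set (E d)}

/-- The Sinkhorn step for exponential potentials. -/
def sinkPot (ε : ℝ) (b : Measure Ω) (m : ℝ) (v : Ω → ℝ) (x : Ω) : ℝ :=
  (max 1 (costBdry x * ((∫ y, v y * gibbs ε x y ∂b) / m)))⁻¹

/-- Measurable functions with values in the unit interval. -/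
structure IsUnit01 (v : Ω → ℝ) : Prop where
  measurable : Measurable v
  nonneg : ∀ x, 0 ≤ v x
  le_one : ∀ x, v x ≤ 1

theorem IsPot.isUnit01 {u : Ω → ℝ} (h : IsPot u) : IsUnit01 u :=
  ⟨h.continuous.measurable, fun x => (h.pos x).le, h.le_one⟩

theorem exists_gibbs_le (hΩb : Bornology.IsBounded Ω) (ε : ℝ) :
    ∃ K, 0 ≤ K ∧ ∀ x y : Ω, gibbs ε x y ≤ K := by
  obtain ⟨K, hK⟩ := (isBC_gibbs hΩb ε).bounded
  exact ⟨max K 0, le_max_right _ _,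
    fun x y => ((le_abs_self _).trans (hK (x, y))).trans (le_max_left _ _)⟩

theorem continuous_gibbs_right (ε : ℝ) (x : Ω) : Continuous fun y : Ω => gibbs ε x y := by
  have h := (((continuous_costBdry (Ω := Ω)).const_add (costBdry x)).sub
    (continuous_cost.comp (Continuous.prodMk_right x))).div_const ε
  exact h.rexp

theorem continuous_gibbs_left (ε : ℝ) (y : Ω) : Continuous fun x : Ω => gibbs ε x y := by
  simp only [gibbs_comm ε _ y]
  exact continuous_gibbs_right ε y

section

variable {b : Measure Ω} {v v' : Ω → ℝ}

theorem IsUnit01.integral_mul_gibbs_nonneg (hv : IsUnit01 v) (ε : ℝ) (x : Ω) :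
    0 ≤ ∫ y, v y * gibbs ε x y ∂b :=
  integral_nonneg fun y => mul_nonneg (hv.nonneg y) (gibbs_pos _ _ _).le

theorem costBdry_mul_sinkPot_le (x : Ω) (ε m : ℝ) :
    costBdry x * sinkPot ε b m v x * ((∫ y, v y * gibbs ε x y ∂b) / m) ≤ 1 := by
  rw [sinkPot, mul_right_comm]
  exact mul_inv_le_one_of_le₀ (le_max_right _ _) (lt_max_of_lt_left one_pos).le

theorem costBdry_mul_sinkPot_eq {x : Ω} {ε m : ℝ} (h : sinkPot ε b m v x < 1) :
    costBdry x * sinkPot ε b m v x * ((∫ y, v y * gibbs ε x y ∂b) / m) = 1 := by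
  have h0 : (0 : ℝ) < max 1 (costBdry x * ((∫ y, v y * gibbs ε x y ∂b) / m)) :=
    lt_max_of_lt_left one_pos
  have h1 := (inv_lt_one₀ h0).1 h
  rw [sinkPot, mul_right_comm, max_eq_right (by
    rcases lt_max_iff.1 h1 with h | h
    · exact absurd h (lt_irrefl _)
    · exact h.le)]
  refine mul_inv_cancel₀ ?_
  rcases lt_max_iff.1 h1 with h | h
  · exact absurd h (lt_irrefl _)
  · linarith

variable [IsFiniteMeasure b]

theorem IsUnit01.integrable_mul_gibbs (hv : IsUnit01 v) (hΩb : Bornology.IsBounded Ω) (ε : ℝ)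
    (x : Ω) : Integrable (fun y => v y * gibbs ε x y) b := by
  obtain ⟨K, -, hK⟩ := exists_gibbs_le hΩb ε
  have hc := continuous_gibbs_right ε x
  refine Integrable.of_bound (hv.measurable.mul hc.measurable).aestronglyMeasurable K
    (Eventually.of_forall fun y => ?_)
  rw [Real.norm_eq_abs, abs_of_nonneg (mul_nonneg (hv.nonneg y) (gibbs_pos _ _ _).le)]
  exact (mul_le_of_le_one_left (gibbs_pos _ _ _).le (hv.le_one y)).trans (hK x y)

theorem IsUnit01.integral_mul_gibbs_le (hv : IsUnit01 v) (hΩb : Bornology.IsBounded Ω) (ε : ℝ)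
    {K : ℝ} (hK : ∀ x y : Ω, gibbs ε x y ≤ K) (x : Ω) :
    ∫ y, v y * gibbs ε x y ∂b ≤ K * b.real Set.univ := by
  have := integral_mono (hv.integrable_mul_gibbs (b := b) hΩb ε x) (integrable_const K) fun y =>
    (mul_le_of_le_one_left (gibbs_pos _ _ _).le (hv.le_one y)).trans (hK x y)
  simpa [mul_comm] using this

theorem IsUnit01.continuous_integral_mul_gibbs (hv : IsUnit01 v) (hΩb : Bornology.IsBounded Ω)
    (ε : ℝ) : Continuous fun x => ∫ y, v y * gibbs ε x y ∂b := by
  obtain ⟨K, -, hK⟩ := exists_gibbs_le hΩb ε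
  refine continuous_of_dominated (bound := fun _ => K)
    (fun x => (hv.integrable_mul_gibbs hΩb ε x).aestronglyMeasurable)
    (fun x => Eventually.of_forall fun y => ?_) (integrable_const _)
    (Eventually.of_forall fun y => ?_)
  · rw [Real.norm_eq_abs, abs_of_nonneg (mul_nonneg (hv.nonneg y) (gibbs_pos _ _ _).le)]
    exact (mul_le_of_le_one_left (gibbs_pos _ _ _).le (hv.le_one y)).trans (hK x y)
  · exact continuous_const.mul (continuous_gibbs_left ε y)

theorem IsUnit01.isPot_sinkPot (hv : IsUnit01 v) (hΩb : Bornology.IsBounded Ω) (ε : ℝ) {m : ℝ}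
    (hm : 0 < m) : IsPot (sinkPot ε b m v) := by
  have hpos : ∀ x : Ω, 0 < max 1 (costBdry x * ((∫ y, v y * gibbs ε x y ∂b) / m)) :=
    fun x => lt_max_of_lt_left one_pos
  obtain ⟨K, -, hK⟩ := exists_gibbs_le hΩb ε
  refine ⟨?_, fun x => inv_pos.2 (hpos x), fun x => inv_le_one_of_one_le₀ (le_max_left _ _),
    K * b.real Set.univ / m, fun x => ?_⟩
  · exact (continuous_const.max (continuous_costBdry.mul
      ((hv.continuous_integral_mul_gibbs hΩb ε).div_const m))).inv₀ fun x => (hpos x).ne'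
  · rw [sinkPot, Real.log_inv, neg_neg, mul_comm (K * _ / m)]
    have h0 := mul_nonneg (costBdry_nonneg x)
      (div_nonneg (hv.integral_mul_gibbs_nonneg (b := b) ε x) hm.le)
    have h1 := Real.log_le_sub_one_of_pos (hpos x)
    have h2 : max 1 (costBdry x * ((∫ y, v y * gibbs ε x y ∂b) / m)) - 1
        ≤ costBdry x * ((∫ y, v y * gibbs ε x y ∂b) / m) := by
      rcases max_cases 1 (costBdry x * ((∫ y, v y * gibbs ε x y ∂b) / m)) with h | h <;> linarith
    refine (h1.trans h2).trans (mul_le_mul_of_nonneg_left ?_ (costBdry_nonneg x))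
    exact div_le_div_of_nonneg_right (hv.integral_mul_gibbs_le hΩb ε hK x) hm.le

theorem sinkPot_antitone (hv : IsUnit01 v) (hv' : IsUnit01 v') (hΩb : Bornology.IsBounded Ω)
    (ε : ℝ) {m : ℝ} (hm : 0 < m) (h : ∀ x, v x ≤ v' x) (x : Ω) :
    sinkPot ε b m v' x ≤ sinkPot ε b m v x := by
  refine inv_anti₀ (lt_max_of_lt_left one_pos) (max_le_max le_rfl
    (mul_le_mul_of_nonneg_left (div_le_div_of_nonneg_right ?_ hm.le) (costBdry_nonneg x)))
  exact integral_mono (hv.integrable_mul_gibbs hΩb ε x) (hv'.integrable_mul_gibbs hΩb ε x)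
    fun y => mul_le_mul_of_nonneg_right (h y) (gibbs_pos _ _ _).le

theorem tendsto_sinkPot {w : ℕ → Ω → ℝ} (hw : ∀ n, IsUnit01 (w n)) (hΩb : Bornology.IsBounded Ω)
    (ε : ℝ) (m : ℝ) (h : ∀ x, Tendsto (fun n => w n x) atTop (𝓝 (v x))) (x : Ω) :
    Tendsto (fun n => sinkPot ε b m (w n) x) atTop (𝓝 (sinkPot ε b m v x)) := by
  obtain ⟨K, -, hK⟩ := exists_gibbs_le hΩb ε
  have h1 : Tendsto (fun n => ∫ y, w n y * gibbs ε x y ∂b) atTop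
      (𝓝 (∫ y, v y * gibbs ε x y ∂b)) := by
    refine tendsto_integral_of_dominated_convergence (fun _ => K)
      (fun n => ((hw n).integrable_mul_gibbs hΩb ε x).aestronglyMeasurable) (integrable_const _)
      (fun n => Eventually.of_forall fun y => ?_)
      (Eventually.of_forall fun y => (h y).mul_const _)
    rw [Real.norm_eq_abs, abs_of_nonneg (mul_nonneg ((hw n).nonneg y) (gibbs_pos _ _ _).le)]
    exact (mul_le_of_le_one_left (gibbs_pos _ _ _).le ((hw n).le_one y)).trans (hK x y)
  exact (tendsto_const_nhds.max (tendsto_const_nhds.mul (h1.div_const m))).inv₀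
    (lt_max_of_lt_left one_pos).ne'

end

/-- Existence of optimal exponential potentials, by monotone iteration. -/
theorem exists_sinkPot_fixed (hΩb : Bornology.IsBounded Ω) (ε : ℝ) (a b : Measure Ω)
    [IsFiniteMeasure a] [IsFiniteMeasure b] {m : ℝ} (hm : 0 < m) :
    ∃ u v : Ω → ℝ, IsPot u ∧ IsPot v ∧ u = sinkPot ε b m v ∧ v = sinkPot ε a m u := by
  let V : ℕ → Ω → ℝ := fun n => (fun w => sinkPot ε a m (sinkPot ε b m w))^[n] 0
  have hV : ∀ n, V (n + 1) = sinkPot ε a m (sinkPot ε b m (V n)) := fun n =>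
    Function.iterate_succ_apply' _ _ _
  have h01 : ∀ n, IsUnit01 (V n) := fun n => by
    induction n with
    | zero => exact ⟨measurable_const, fun _ => le_rfl, fun _ => zero_le_one⟩
    | succ n ih =>
      rw [hV]
      exact ((ih.isPot_sinkPot hΩb ε hm).isUnit01.isPot_sinkPot hΩb ε hm).isUnit01
  have hU01 : ∀ n, IsUnit01 (sinkPot ε b m (V n)) := fun n =>
    ((h01 n).isPot_sinkPot hΩb ε hm).isUnit01
  have hmono : ∀ n x, V n x ≤ V (n + 1) x := fun n => by
    induction n with
    | zero => exact fun x => (h01 1).nonneg x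
    | succ n ih =>
      intro x
      rw [hV, hV (n + 1)]
      exact sinkPot_antitone (hU01 _) (hU01 _) hΩb ε hm
        (sinkPot_antitone (h01 _) (h01 _) hΩb ε hm ih) x
  let v : Ω → ℝ := fun x => ⨆ n, V n x
  have hlim : ∀ x, Tendsto (fun n => V n x) atTop (𝓝 (v x)) := fun x =>
    tendsto_atTop_ciSup (monotone_nat_of_le_succ fun n => hmono n x)
      ⟨1, by rintro _ ⟨n, rfl⟩; exact (h01 n).le_one x⟩
  have hv : IsUnit01 v :=
    ⟨measurable_of_tendsto_metrizable (fun n => (h01 n).measurable) (tendsto_pi_nhds.2 hlim),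
      fun x => ge_of_tendsto' (hlim x) fun n => (h01 n).nonneg x,
      fun x => le_of_tendsto' (hlim x) fun n => (h01 n).le_one x⟩
  have hu := hv.isPot_sinkPot (b := b) hΩb ε hm
  have hfix : v = sinkPot ε a m (sinkPot ε b m v) := by
    funext x
    have h1 := tendsto_sinkPot (b := a) hU01 hΩb ε m
      (tendsto_sinkPot (b := b) h01 hΩb ε m hlim) x
    simp only [← hV] at h1
    exact tendsto_nhds_unique ((tendsto_add_atTop_iff_nat 1).2 (hlim x)) h1
  exact ⟨sinkPot ε b m v, v, hu, hfix ▸ hu.isUnit01.isPot_sinkPot hΩb ε hm, rfl, hfix⟩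

theorem geomMass_comm (a b : Measure Ω) : geomMass a b = geomMass b a := by
  rw [geomMass, geomMass, mul_comm]

theorem integral_prod_log_left (hpos : ∀ x : Ω, 0 < costBdry x) (hΩb : Bornology.IsBounded Ω)
    {ε : ℝ} {a b : Measure Ω} [IsFiniteMeasure a] [IsFiniteMeasure b] {u v : Ω → ℝ}
    (hu : IsPot u) (hv : IsPot v) {m : ℝ} (h : u = sinkPot ε b m v) :
    (∫ p, u p.1 * v p.2 * gibbs ε p.1 p.2 * Real.log (u p.1) ∂(a.prod b)) / m
      = ∫ x, Real.log (u x) / costBdry x ∂a := by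
  rw [integral_prod _ (((((hu.isBC.comp continuous_fst).mul (hv.isBC.comp continuous_snd)).mul
    (isBC_gibbs hΩb ε)).mul ((hu.isBC_log hpos hΩb).comp continuous_fst)).integrable _),
    ← integral_div]
  refine integral_congr_ae (Eventually.of_forall fun x => ?_)
  have e : ∀ y, u x * v y * gibbs ε x y * Real.log (u x)
      = u x * Real.log (u x) * (v y * gibbs ε x y) := fun y => by ring
  simp only [e, integral_const_mul]
  rcases (hu.le_one x).eq_or_lt with h1 | h1
  · rw [h1]; simp
  · have := costBdry_mul_sinkPot_eq (b := b) (v := v) (m := m) (x := x) (ε := ε) (h ▸ h1)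
    rw [← h] at this
    rw [eq_div_iff (hpos x).ne']
    linear_combination Real.log (u x) * this

theorem integral_prod_log_right (hpos : ∀ x : Ω, 0 < costBdry x) (hΩb : Bornology.IsBounded Ω)
    {ε : ℝ} {a b : Measure Ω} [IsFiniteMeasure a] [IsFiniteMeasure b] {u v : Ω → ℝ}
    (hu : IsPot u) (hv : IsPot v) {m : ℝ} (h : v = sinkPot ε a m u) :
    (∫ p, u p.1 * v p.2 * gibbs ε p.1 p.2 * Real.log (v p.2) ∂(a.prod b)) / m
      = ∫ x, Real.log (v x) / costBdry x ∂b := by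
  rw [← integral_prod_log_left (b := a) hpos hΩb hv hu h, ← integral_prod_swap]
  congr 2
  funext p
  simp only [Prod.fst_swap, Prod.snd_swap]
  rw [gibbs_comm, mul_comm (u _)]

theorem gibbsVal_eq (hpos : ∀ x : Ω, 0 < costBdry x) (hΩb : Bornology.IsBounded Ω)
    (ε : ℝ) (a b : Measure Ω) [IsFiniteMeasure a] [IsFiniteMeasure b] {u v : Ω → ℝ}
    (hu : IsPot u) (hv : IsPot v) (s : ℝ) :
    gibbsVal ε a b u v s = (1 + ε / 2) * (a.real Set.univ + b.real Set.univ)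
      + ε * (s / geomMass a b *
        ((Real.log s - 1) * (∫ p, u p.1 * v p.2 * gibbs ε p.1 p.2 ∂(a.prod b))
        + (∫ p, (u p.1 * Real.log (u p.1)) * v p.2 * gibbs ε p.1 p.2 ∂(a.prod b)
        + ∫ p, u p.1 * (v p.2 * Real.log (v p.2)) * gibbs ε p.1 p.2 ∂(a.prod b)))) := by
  have bu := hu.isBC.mul (hu.isBC_log hpos hΩb)
  have bv := hv.isBC.mul (hv.isBC_log hpos hΩb)
  have B : ∀ {p q : Ω → ℝ}, IsBC p → IsBC q →
      IsBC fun z : Ω × Ω => p z.1 * q z.2 * gibbs ε z.1 z.2 := fun hp hq =>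
    ((hp.comp continuous_fst).mul (hq.comp continuous_snd)).mul (isBC_gibbs hΩb ε)
  rw [gibbsVal]
  congr 3
  rw [← integral_const_mul, ← integral_add ((B bu hv.isBC).integrable _)
    ((B hu.isBC bv).integrable _), ← integral_add
    (((IsBC.const _).mul (B hu.isBC hv.isBC)).integrable _)
    (((B bu hv.isBC).add (B hu.isBC bv)).integrable _)]
  refine integral_congr_ae (Eventually.of_forall fun p => ?_)
  ring

theorem gibbsVal_one (hpos : ∀ x : Ω, 0 < costBdry x) (hΩb : Bornology.IsBounded Ω) {ε : ℝ}
    {a b : Measure Ω} [IsFiniteMeasure a] [IsFiniteMeasure b] {u v : Ω → ℝ} (hu : IsPot u)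
    (hv : IsPot v) (h1 : u = sinkPot ε b (geomMass a b) v)
    (h2 : v = sinkPot ε a (geomMass a b) u) : gibbsVal ε a b u v 1 = dualVal ε a b u v := by
  rw [gibbsVal_eq hpos hΩb ε a b hu hv, dualVal, ← integral_prod_log_left hpos hΩb hu hv h1,
    ← integral_prod_log_right hpos hΩb hu hv h2, Real.log_one]
  have e1 : ∀ p : Ω × Ω, u p.1 * v p.2 * gibbs ε p.1 p.2 * Real.log (u p.1)
    = (u p.1 * Real.log (u p.1)) * v p.2 * gibbs ε p.1 p.2 := fun p => by ring
  have e2 : ∀ p : Ω × Ω, u p.1 * v p.2 * gibbs ε p.1 p.2 * Real.log (v p.2)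
    = u p.1 * (v p.2 * Real.log (v p.2)) * gibbs ε p.1 p.2 := fun p => by ring
  simp only [e1, e2]
  ring

/-- Strong duality at fixed points of the Sinkhorn iteration. -/
theorem FG_eq_dualVal (hpos : ∀ x : Ω, 0 < costBdry x) (hΩb : Bornology.IsBounded Ω)
    {ε : ℝ} (hε : 0 < ε) {α β : Measure Ω} (hα : FinPers α) (hβ : FinPers β)
    (hα0 : α ≠ 0) (hβ0 : β ≠ 0) {u v : Ω → ℝ} (hu : IsPot u) (hv : IsPot v)
    (h1 : u = sinkPot ε (hat β) (geomMass (hat α) (hat β)) v)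
    (h2 : v = sinkPot ε (hat α) (geomMass (hat α) (hat β)) u) :
    (FG ε α β).toReal = dualVal ε (hat α) (hat β) u v := by
  have := hα.isFiniteMeasure_hat
  have := hβ.isFiniteMeasure_hat
  refine le_antisymm ?_ (dualVal_le_FG hpos hΩb hε hα hβ hα0 hβ0 hu hv)
  refine (FG_le_of_feasible hpos hΩb hε hα hβ hα0 hβ0 hu hv one_pos (fun x => ?_)
    fun y => ?_).trans_eq (gibbsVal_one hpos hΩb hu hv h1 h2)
  · rw [one_mul]; nth_rewrite 1 [h1]; exact costBdry_mul_sinkPot_le _ _ _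
  · rw [one_mul]; nth_rewrite 1 [h2]; exact costBdry_mul_sinkPot_le _ _ _

theorem exists_FG_eq_dualVal (hpos : ∀ x : Ω, 0 < costBdry x) (hΩb : Bornology.IsBounded Ω)
    {ε : ℝ} (hε : 0 < ε) {α β : Measure Ω} (hα : FinPers α) (hβ : FinPers β)
    (hα0 : α ≠ 0) (hβ0 : β ≠ 0) :
    ∃ u v : Ω → ℝ, IsPot u ∧ IsPot v ∧
      u = sinkPot ε (hat β) (geomMass (hat α) (hat β)) v ∧
      v = sinkPot ε (hat α) (geomMass (hat α) (hat β)) u ∧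
      (FG ε α β).toReal = dualVal ε (hat α) (hat β) u v := by
  have := hα.isFiniteMeasure_hat
  have := hβ.isFiniteMeasure_hat
  obtain ⟨u, v, hu, hv, h1, h2⟩ := exists_sinkPot_fixed hΩb ε (hat α) (hat β)
    (geomMass_pos (mt (hat_eq_zero_iff hpos).1 hα0) (mt (hat_eq_zero_iff hpos).1 hβ0))
  exact ⟨u, v, hu, hv, h1, h2, FG_eq_dualVal hpos hΩb hε hα hβ hα0 hβ0 hu hv h1 h2⟩

end

noncomputable section

variable {d : ℕ} {Ω : Set (E d)}

theorem geomMass_self (a : Measure Ω) : geomMass a a = a.real Set.univ :=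
  Real.sqrt_mul_self measureReal_nonneg

theorem IsPot.sqrt_mul {u v : Ω → ℝ} (hu : IsPot u) (hv : IsPot v) :
    IsPot fun x => √(u x * v x) := by
  have hp : ∀ x, 0 < u x * v x := fun x => mul_pos (hu.pos x) (hv.pos x)
  obtain ⟨C, hC⟩ := hu.bound
  obtain ⟨D, hD⟩ := hv.bound
  refine ⟨(hu.continuous.mul hv.continuous).sqrt, fun x => Real.sqrt_pos.2 (hp x),
    fun x => Real.sqrt_le_one.2 (mul_le_one₀ (hu.le_one x) (hv.pos x).le (hv.le_one x)),
    (C + D) / 2, fun x => ?_⟩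
  rw [Real.log_sqrt (hp x).le, Real.log_mul (hu.pos x).ne' (hv.pos x).ne']
  linarith [hC x, hD x]

theorem isBC_mul_gibbs (hΩb : Bornology.IsBounded Ω) (ε : ℝ) {u v : Ω → ℝ} (hu : IsPot u)
    (hv : IsPot v) : IsBC fun p : Ω × Ω => u p.1 * v p.2 * gibbs ε p.1 p.2 :=
  ((hu.isBC.comp continuous_fst).mul (hv.isBC.comp continuous_snd)).mul (isBC_gibbs hΩb ε)

theorem eq_and_eq_of_add_eq_two_mul {x y z : ℝ} (h1 : x * y = z * z) (h2 : x + y = 2 * z) :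
    x = z ∧ y = z := by
  have h : (x - y) ^ 2 = 0 := by
    have : (x + y) ^ 2 = 4 * (z * z) := by rw [h2]; ring
    nlinarith
  have h3 : x - y = 0 := pow_eq_zero_iff two_ne_zero |>.1 h
  constructor <;> linarith

/-- Existence of a symmetric optimal exponential potential for `(α, α)`. -/
theorem exists_symm_potential (hpos : ∀ x : Ω, 0 < costBdry x) (hΩb : Bornology.IsBounded Ω)
    {ε : ℝ} (hε : 0 < ε) {α : Measure Ω} (hα : FinPers α) (hα0 : α ≠ 0) :
    ∃ t : Ω → ℝ, IsPot t ∧ (FG ε α α).toReal = dualVal ε (hat α) (hat α) t t ∧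
      ∀ᵐ x ∂(hat α), t x = sinkPot ε (hat α) ((hat α).real Set.univ) t x := by
  have := hα.isFiniteMeasure_hat
  have hm := measureReal_univ_pos (mt (hat_eq_zero_iff hpos).1 hα0)
  obtain ⟨u, v, hu, hv, h1, h2, hFG⟩ := exists_FG_eq_dualVal hpos hΩb hε hα hα hα0 hα0
  rw [geomMass_self] at h1 h2
  set a := hat α
  set m := a.real Set.univ
  set t : Ω → ℝ := fun x => √(u x * v x) with ht
  have htP : IsPot t := hu.sqrt_mul hv
  have htt : ∀ x, t x * t x = u x * v x := fun x =>
    Real.mul_self_sqrt (mul_pos (hu.pos x) (hv.pos x)).le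
  have hle := dualVal_le_FG hpos hΩb hε hα hα hα0 hα0 htP htP
  have iuv := (isBC_mul_gibbs hΩb ε hu hv).integrable (a.prod a)
  have ivu := (isBC_mul_gibbs hΩb ε hv hu).integrable (a.prod a)
  have itt := (isBC_mul_gibbs hΩb ε htP htP).integrable (a.prod a)
  have hlog : 2 * ∫ x, Real.log (t x) / costBdry x ∂a
      = ∫ x, Real.log (u x) / costBdry x ∂a + ∫ x, Real.log (v x) / costBdry x ∂a := by
    rw [← integral_add ((hu.isBC_log_div hpos).integrable a)
      ((hv.isBC_log_div hpos).integrable a), ← integral_const_mul]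
    refine integral_congr_ae (Eventually.of_forall fun x => ?_)
    simp only [ht]
    rw [Real.log_sqrt (mul_pos (hu.pos x) (hv.pos x)).le,
      Real.log_mul (hu.pos x).ne' (hv.pos x).ne']
    ring
  have hswap : ∫ p, v p.1 * u p.2 * gibbs ε p.1 p.2 ∂(a.prod a)
      = ∫ p, u p.1 * v p.2 * gibbs ε p.1 p.2 ∂(a.prod a) := by
    rw [← integral_prod_swap]
    refine integral_congr_ae (Eventually.of_forall fun p => ?_)
    simp only [Prod.fst_swap, Prod.snd_swap]
    rw [gibbs_comm, mul_comm (v _)]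
  have hnn : ∀ p : Ω × Ω, 0 ≤ u p.1 * v p.2 * gibbs ε p.1 p.2 + v p.1 * u p.2 * gibbs ε p.1 p.2
      - 2 * (t p.1 * t p.2 * gibbs ε p.1 p.2) := fun p => by
    have e1 : t p.1 * t p.2 = √(u p.1 * v p.2) * √(v p.1 * u p.2) := by
      simp only [ht]
      rw [← Real.sqrt_mul (mul_pos (hu.pos _) (hv.pos _)).le,
        ← Real.sqrt_mul (mul_pos (hu.pos _) (hv.pos _)).le]
      congr 1; ring
    have e2 := Real.mul_self_sqrt (mul_pos (hu.pos p.1) (hv.pos p.2)).le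
    have e3 := Real.mul_self_sqrt (mul_pos (hv.pos p.1) (hu.pos p.2)).le
    rw [e1]
    refine le_of_le_of_eq (mul_nonneg (sq_nonneg (√(u p.1 * v p.2) - √(v p.1 * u p.2)))
      (gibbs_pos ε p.1 p.2).le) ?_
    linear_combination gibbs ε p.1 p.2 * (e2 + e3)
  have hint : ∫ p, (u p.1 * v p.2 * gibbs ε p.1 p.2 + v p.1 * u p.2 * gibbs ε p.1 p.2
      - 2 * (t p.1 * t p.2 * gibbs ε p.1 p.2)) ∂(a.prod a)
      = 2 * ∫ p, u p.1 * v p.2 * gibbs ε p.1 p.2 ∂(a.prod a)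
        - 2 * ∫ p, t p.1 * t p.2 * gibbs ε p.1 p.2 ∂(a.prod a) := by
    rw [integral_sub (((isBC_mul_gibbs hΩb ε hu hv).add (isBC_mul_gibbs hΩb ε hv hu)).integrable _)
      (itt.const_mul 2), integral_add iuv ivu, hswap, integral_const_mul]
    ring
  have hge : 0 ≤ 2 * ∫ p, u p.1 * v p.2 * gibbs ε p.1 p.2 ∂(a.prod a)
        - 2 * ∫ p, t p.1 * t p.2 * gibbs ε p.1 p.2 ∂(a.prod a) := by
    rw [← hint]; exact integral_nonneg hnn
  have hFG' := hFG
  rw [hFG'] at hle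
  unfold dualVal at hle
  rw [geomMass_self, ← two_mul (∫ x, Real.log (t x) / costBdry x ∂a), hlog] at hle
  have h3 := le_of_mul_le_mul_left (le_of_add_le_add_left hle) hε
  rw [sub_le_sub_iff_left, div_le_div_iff_of_pos_right hm] at h3
  have heq : ∫ p, t p.1 * t p.2 * gibbs ε p.1 p.2 ∂(a.prod a)
      = ∫ p, u p.1 * v p.2 * gibbs ε p.1 p.2 ∂(a.prod a) := by linarith
  refine ⟨t, htP, ?_, ?_⟩
  · rw [hFG]
    unfold dualVal
    rw [← two_mul (∫ x, Real.log (t x) / costBdry x ∂a), hlog, heq]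
  have hzero : ∀ᵐ p ∂(a.prod a), u p.1 * v p.2 * gibbs ε p.1 p.2 + v p.1 * u p.2 * gibbs ε p.1 p.2
      - 2 * (t p.1 * t p.2 * gibbs ε p.1 p.2) = 0 := by
    refine (integral_eq_zero_iff_of_nonneg hnn ((iuv.add ivu).sub (itt.const_mul 2))).1 ?_
    rw [hint, heq, sub_self]
  filter_upwards [Measure.ae_ae_of_ae_prod hzero] with x hx
  have hxy : ∀ᵐ y ∂a, u x * (v y * gibbs ε x y) = t x * (t y * gibbs ε x y) ∧
      v x * (u y * gibbs ε x y) = t x * (t y * gibbs ε x y) := by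
    filter_upwards [hx] with y hy
    simp only [← mul_assoc]
    refine eq_and_eq_of_add_eq_two_mul ?_ (sub_eq_zero.1 hy)
    linear_combination gibbs ε x y ^ 2 * (-(t x * t x) * htt y - u y * v y * htt x)
  have i1 : u x * ∫ y, v y * gibbs ε x y ∂a = t x * ∫ y, t y * gibbs ε x y ∂a := by
    rw [← integral_const_mul, ← integral_const_mul]
    exact integral_congr_ae (hxy.mono fun y h => h.1)
  have i2 : v x * ∫ y, u y * gibbs ε x y ∂a = t x * ∫ y, t y * gibbs ε x y ∂a := by
    rw [← integral_const_mul, ← integral_const_mul]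
    exact integral_congr_ae (hxy.mono fun y h => h.2)
  have j1 : costBdry x * u x * ((∫ y, v y * gibbs ε x y ∂a) / m)
      = t x * (costBdry x * ((∫ y, t y * gibbs ε x y ∂a) / m)) := by
    linear_combination costBdry x / m * i1
  have j2 : costBdry x * v x * ((∫ y, u y * gibbs ε x y ∂a) / m)
      = t x * (costBdry x * ((∫ y, t y * gibbs ε x y ∂a) / m)) := by
    linear_combination costBdry x / m * i2
  rcases (htP.le_one x).eq_or_lt with ht1 | ht1
  · have := costBdry_mul_sinkPot_le (b := a) (v := v) x ε m
    rw [← h1, j1, ht1, one_mul] at this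
    rw [sinkPot, max_eq_left this, ht1, inv_one]
  · have hone : t x * (costBdry x * ((∫ y, t y * gibbs ε x y ∂a) / m)) = 1 := by
      by_cases hu1 : u x < 1
      · have := costBdry_mul_sinkPot_eq (b := a) (v := v) (x := x) (ε := ε) (m := m) (h1 ▸ hu1)
        rwa [← h1, j1] at this
      · have hv1 : v x < 1 := by
          by_contra hv1
          have e1 : u x = 1 := le_antisymm (hu.le_one x) (not_lt.1 hu1)
          have e2 : v x = 1 := le_antisymm (hv.le_one x) (not_lt.1 hv1)
          simp [ht, e1, e2] at ht1
        have := costBdry_mul_sinkPot_eq (b := a) (v := u) (x := x) (ε := ε) (m := m) (h2 ▸ hv1)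
        rwa [← h2, j2] at this
    have hinv := eq_inv_of_mul_eq_one_right hone
    rw [sinkPot, hinv, max_eq_right ((one_le_inv₀ (htP.pos x)).2 ht1.le), inv_inv]

/-- The measure `u e^{c_∂ / ε} a / √m(a)`. -/
def kernelMeasure (ε : ℝ) (a : Measure Ω) (u : Ω → ℝ) : Measure Ω :=
  a.withDensity fun x =>
    ENNReal.ofReal (u x * Real.exp (costBdry x / ε) / √(a.real Set.univ))

theorem gibbs_eq (ε : ℝ) (x y : Ω) : gibbs ε x y
    = Real.exp (costBdry x / ε) * (Real.exp (costBdry y / ε) * expKernel ε x y) := by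
  rw [gibbs, expKernel, ← Real.exp_add, ← Real.exp_add]
  congr 1; ring

theorem IsPot.isBC_density (hΩb : Bornology.IsBounded Ω) (ε c : ℝ) {u : Ω → ℝ} (hu : IsPot u) :
    IsBC fun x => u x * Real.exp (costBdry x / ε) / c :=
  (hu.isBC.mul ((isBC_costBdry hΩb).div_const ε).exp).div_const c

theorem IsPot.density_nonneg (ε : ℝ) (a : Measure Ω) {u : Ω → ℝ} (hu : IsPot u) (x : Ω) :
    0 ≤ u x * Real.exp (costBdry x / ε) / √(a.real Set.univ) :=
  div_nonneg (mul_nonneg (hu.pos x).le (Real.exp_pos _).le) (Real.sqrt_nonneg _)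

theorem integral_kernelMeasure (hΩb : Bornology.IsBounded Ω) (ε : ℝ) (a : Measure Ω) {u : Ω → ℝ}
    (hu : IsPot u) (f : Ω → ℝ) : ∫ x, f x ∂(kernelMeasure ε a u)
      = ∫ x, u x * Real.exp (costBdry x / ε) / √(a.real Set.univ) * f x ∂a := by
  rw [kernelMeasure, integral_withDensity_eq_integral_toReal_smul
    (hu.isBC_density hΩb ε _).continuous.measurable.ennreal_ofReal
    (Eventually.of_forall fun _ => ENNReal.ofReal_lt_top)]
  refine integral_congr_ae (Eventually.of_forall fun x => ?_)
  simp only [ENNReal.toReal_ofReal (hu.density_nonneg ε a x), smul_eq_mul]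

theorem integral_expKernel_kernelMeasure (hΩb : Bornology.IsBounded Ω) (ε : ℝ) (a : Measure Ω)
    {u : Ω → ℝ} (hu : IsPot u) (x : Ω) : Real.exp (costBdry x / ε) *
      ∫ y, expKernel ε x y ∂(kernelMeasure ε a u)
      = (∫ y, u y * gibbs ε x y ∂a) / √(a.real Set.univ) := by
  rw [integral_kernelMeasure hΩb ε a hu, ← integral_const_mul, ← integral_div]
  refine integral_congr_ae (Eventually.of_forall fun y => ?_)
  simp only [gibbs_eq]
  ring

theorem kernelInner_kernelMeasure (hΩb : Bornology.IsBounded Ω) (ε : ℝ) (a b : Measure Ω)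
    [IsFiniteMeasure a] [IsFiniteMeasure b] {u v : Ω → ℝ} (hu : IsPot u) (hv : IsPot v) :
    kernelInner (expKernel ε) (kernelMeasure ε a u) (kernelMeasure ε b v)
      = (∫ p, u p.1 * v p.2 * gibbs ε p.1 p.2 ∂(a.prod b)) / geomMass a b := by
  rw [kernelInner, integral_kernelMeasure hΩb ε a hu,
    integral_prod _ ((isBC_mul_gibbs hΩb ε hu hv).integrable _), ← integral_div]
  refine integral_congr_ae (Eventually.of_forall fun x => ?_)
  have e := integral_expKernel_kernelMeasure hΩb ε b hv x
  simp only [mul_assoc, integral_const_mul]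
  rw [geomMass, Real.sqrt_mul measureReal_nonneg]
  linear_combination u x / √(a.real Set.univ) * e

/-- The function `c_∂ e^{c_∂ / ε} ∫ K_ε(·, y) dμ(y)`. -/
def kernelPotential (ε : ℝ) (μ : Measure Ω) (x : Ω) : ℝ :=
  costBdry x * (Real.exp (costBdry x / ε) * ∫ y, expKernel ε x y ∂μ)

theorem kernelPotential_nonneg (ε : ℝ) (μ : Measure Ω) (x : Ω) : 0 ≤ kernelPotential ε μ x :=
  mul_nonneg (costBdry_nonneg x) (mul_nonneg (Real.exp_pos _).le
    (integral_nonneg fun _ => (Real.exp_pos _).le))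

theorem eq_withDensity_kernelMeasure (hΩb : Bornology.IsBounded Ω) (ε : ℝ) {a : Measure Ω}
    [IsFiniteMeasure a] (ha : a ≠ 0) {t : Ω → ℝ} (ht : IsPot t)
    (hfix : ∀ᵐ x ∂a, t x = sinkPot ε a (a.real Set.univ) t x) :
    a = (kernelMeasure ε a t).withDensity fun x => ENNReal.ofReal (Real.exp (-(costBdry x / ε))
      * max √(a.real Set.univ) (kernelPotential ε (kernelMeasure ε a t) x)) := by
  have hs : 0 < √(a.real Set.univ) := Real.sqrt_pos.2 (measureReal_univ_pos ha)
  have hm := (ht.isBC_density hΩb ε √(a.real Set.univ)).continuous.measurable.ennreal_ofReal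
  have e1 : (fun x => ENNReal.ofReal (Real.exp (-(costBdry x / ε))
      * max √(a.real Set.univ) (kernelPotential ε (kernelMeasure ε a t) x)))
      =ᵐ[kernelMeasure ε a t] fun x => (ENNReal.ofReal
        (t x * Real.exp (costBdry x / ε) / √(a.real Set.univ)))⁻¹ := by
    refine (withDensity_absolutelyContinuous a _).ae_le ?_
    filter_upwards [hfix] with x hx
    have hp : 0 < t x * Real.exp (costBdry x / ε) / √(a.real Set.univ) :=
      div_pos (mul_pos (ht.pos x) (Real.exp_pos _)) hs
    rw [← ENNReal.ofReal_inv_of_pos hp]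
    congr 1
    rw [inv_div, mul_comm (t x), ← div_div, Real.exp_neg, div_eq_mul_inv _ (t x), hx, sinkPot,
      inv_inv, kernelPotential, integral_expKernel_kernelMeasure hΩb ε a ht x,
      inv_mul_eq_div, div_mul_eq_mul_div, mul_max_of_nonneg _ _ hs.le, mul_one]
    congr 2
    rw [mul_left_comm]
    congr 1
    rw [div_eq_iff hs.ne', mul_right_comm, Real.mul_self_sqrt measureReal_nonneg,
      mul_div_cancel₀ _ (measureReal_univ_pos ha).ne']
  rw [withDensity_congr_ae e1, kernelMeasure]
  have e := withDensity_mul a hm hm.inv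
  refine Eq.trans ?_ e
  nth_rewrite 1 [← withDensity_one (μ := a)]
  congr 1
  funext x
  simp only [Pi.mul_apply, Pi.one_apply, Pi.inv_apply]
  exact (ENNReal.mul_inv_cancel (by
    simpa using div_pos (mul_pos (ht.pos x) (Real.exp_pos (costBdry x / ε))) hs)
    ENNReal.ofReal_ne_top).symm

theorem sqrt_mass_le_of_eq_withDensity {ε : ℝ} {a b μ : Measure Ω} [IsFiniteMeasure a]
    [IsFiniteMeasure b] (ha0 : a ≠ 0) (hb0 : b ≠ 0)
    (ha : a = μ.withDensity fun x => ENNReal.ofReal (Real.exp (-(costBdry x / ε))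
      * max √(a.real Set.univ) (kernelPotential ε μ x)))
    (hb : b = μ.withDensity fun x => ENNReal.ofReal (Real.exp (-(costBdry x / ε))
      * max √(b.real Set.univ) (kernelPotential ε μ x))) :
    √(b.real Set.univ) ≤ √(a.real Set.univ) := by
  set p := √(a.real Set.univ) with hp
  set q := √(b.real Set.univ) with hq
  have hp0 : 0 < p := Real.sqrt_pos.2 (measureReal_univ_pos ha0)
  have hq0 : 0 < q := Real.sqrt_pos.2 (measureReal_univ_pos hb0)
  by_contra! hlt
  have h1 : ENNReal.ofReal p * b Set.univ ≤ ENNReal.ofReal q * a Set.univ := by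
    rw [ha, hb, withDensity_apply _ MeasurableSet.univ, withDensity_apply _ MeasurableSet.univ,
      ← lintegral_const_mul' _ _ ENNReal.ofReal_ne_top,
      ← lintegral_const_mul' _ _ ENNReal.ofReal_ne_top]
    refine lintegral_mono fun x => ?_
    rw [← ENNReal.ofReal_mul hp0.le, ← ENNReal.ofReal_mul hq0.le]
    refine ENNReal.ofReal_le_ofReal ?_
    rw [mul_left_comm, mul_left_comm q, mul_max_of_nonneg _ _ hp0.le, mul_max_of_nonneg _ _ hq0.le,
      mul_comm q p]
    gcongr
    exact kernelPotential_nonneg _ _ _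
  have h2 := ENNReal.toReal_mono (ENNReal.mul_ne_top ENNReal.ofReal_ne_top (measure_ne_top _ _)) h1
  rw [ENNReal.toReal_mul, ENNReal.toReal_mul, ENNReal.toReal_ofReal hp0.le,
    ENNReal.toReal_ofReal hq0.le] at h2
  change p * b.real Set.univ ≤ q * a.real Set.univ at h2
  rw [← Real.mul_self_sqrt (measureReal_nonneg (μ := b)), ← hq,
    ← Real.mul_self_sqrt (measureReal_nonneg (μ := a)), ← hp] at h2
  nlinarith [mul_pos hp0 hq0]

theorem SkFG_nonneg_of_ne_zero (hpos : ∀ x : Ω, 0 < costBdry x) (hΩb : Bornology.IsBounded Ω)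
    {ε : ℝ} (hε : 0 < ε) (hK : IsPosDefKernel (Ω := Ω) (expKernel ε)) {α β : Measure Ω}
    (hα : FinPers α) (hβ : FinPers β) (hα0 : α ≠ 0) (hβ0 : β ≠ 0) :
    0 ≤ SkFG ε α β ∧ (SkFG ε α β = 0 → α = β) := by
  have := hα.isFiniteMeasure_hat
  have := hβ.isFiniteMeasure_hat
  have ha0 := mt (hat_eq_zero_iff hpos).1 hα0
  have hb0 := mt (hat_eq_zero_iff hpos).1 hβ0
  obtain ⟨t, ht, hFt, hft⟩ := exists_symm_potential hpos hΩb hε hα hα0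
  obtain ⟨s, hs, hFs, hfs⟩ := exists_symm_potential hpos hΩb hε hβ hβ0
  have hle := dualVal_le_FG hpos hΩb hε hα hβ hα0 hβ0 ht hs
  have : IsFiniteMeasure (kernelMeasure ε (hat α) t) :=
    isFiniteMeasure_withDensity_isBC (ht.isBC_density hΩb ε _)
  have : IsFiniteMeasure (kernelMeasure ε (hat β) s) :=
    isFiniteMeasure_withDensity_isBC (hs.isBC_density hΩb ε _)
  obtain ⟨hnn, hz⟩ := hK (kernelMeasure ε (hat α) t) (kernelMeasure ε (hat β) s)
  have hsym : kernelInner (expKernel ε) (kernelMeasure ε (hat β) s) (kernelMeasure ε (hat α) t)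
      = kernelInner (expKernel ε) (kernelMeasure ε (hat α) t) (kernelMeasure ε (hat β) s) := by
    rw [kernelInner_kernelMeasure hΩb ε _ _ hs ht, kernelInner_kernelMeasure hΩb ε _ _ ht hs,
      ← integral_prod_swap, geomMass_comm]
    congr 2
    funext p
    simp only [Prod.fst_swap, Prod.snd_swap]
    rw [gibbs_comm, mul_comm (s _)]
  have hbound : ε / 2 * (kernelInner (expKernel ε) (kernelMeasure ε (hat α) t)
        (kernelMeasure ε (hat α) t)
      - kernelInner (expKernel ε) (kernelMeasure ε (hat α) t) (kernelMeasure ε (hat β) s)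
      - kernelInner (expKernel ε) (kernelMeasure ε (hat β) s) (kernelMeasure ε (hat α) t)
      + kernelInner (expKernel ε) (kernelMeasure ε (hat β) s) (kernelMeasure ε (hat β) s))
      ≤ SkFG ε α β := by
    rw [hsym, kernelInner_kernelMeasure hΩb ε _ _ ht ht, kernelInner_kernelMeasure hΩb ε _ _ ht hs,
      kernelInner_kernelMeasure hΩb ε _ _ hs hs, SkFG, hFt, hFs]
    unfold dualVal at hle ⊢
    linarith
  refine ⟨(mul_nonneg (by positivity) hnn).trans hbound, fun h0 => ?_⟩
  rw [h0] at hbound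
  have hμ := hz.1 (le_antisymm (nonpos_of_mul_nonpos_right hbound (by positivity)) hnn)
  have ea := eq_withDensity_kernelMeasure hΩb ε ha0 ht hft
  have eb := eq_withDensity_kernelMeasure hΩb ε hb0 hs hfs
  rw [← hμ] at eb
  have hmass := le_antisymm (sqrt_mass_le_of_eq_withDensity hb0 ha0 eb ea)
    (sqrt_mass_le_of_eq_withDensity ha0 hb0 ea eb)
  refine hat_injective hpos ?_
  rw [ea, eb, hmass]

theorem toReal_pers (μ : Measure Ω) : (pers μ).toReal = (hat μ).real Set.univ := by
  rw [Measure.real, hat_univ]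

theorem FG_self_lt (hpos : ∀ x : Ω, 0 < costBdry x) (hΩb : Bornology.IsBounded Ω)
    {ε : ℝ} (hε : 0 < ε) {α : Measure Ω} (hα : FinPers α) (hα0 : α ≠ 0) :
    (FG ε α α).toReal < 2 * ((1 + ε / 2) * (hat α).real Set.univ) := by
  have := hα.isFiniteMeasure_hat
  have ha0 := mt (hat_eq_zero_iff hpos).1 hα0
  obtain ⟨u, v, hu, hv, -, -, hFG⟩ := exists_FG_eq_dualVal hpos hΩb hε hα hα hα0 hα0
  rw [hFG]
  unfold dualVal
  have l1 : ∀ {w : Ω → ℝ}, IsPot w → ∫ x, Real.log (w x) / costBdry x ∂(hat α) ≤ 0 := fun hw =>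
    integral_nonpos fun x => div_nonpos_of_nonpos_of_nonneg (hw.log_nonpos x) (hpos x).le
  have hp : ∀ p : Ω × Ω, 0 < u p.1 * v p.2 * gibbs ε p.1 p.2 := fun p =>
    mul_pos (mul_pos (hu.pos _) (hv.pos _)) (gibbs_pos _ _ _)
  have l2 : 0 < ∫ p, u p.1 * v p.2 * gibbs ε p.1 p.2 ∂((hat α).prod (hat α)) := by
    rw [integral_pos_iff_support_of_nonneg (fun p => (hp p).le)
      ((isBC_mul_gibbs hΩb ε hu hv).integrable _)]
    have : Function.support (fun p : Ω × Ω => u p.1 * v p.2 * gibbs ε p.1 p.2) = Set.univ :=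
      Set.eq_univ_of_forall fun p => (hp p).ne'
    rw [this, ← Set.univ_prod_univ, Measure.prod_prod]
    exact ENNReal.mul_pos (Measure.measure_univ_ne_zero.2 ha0) (Measure.measure_univ_ne_zero.2 ha0)
  have l3 := div_pos l2 (geomMass_pos ha0 ha0)
  nlinarith [l1 hu, l1 hv, mul_pos hε l3]

theorem toReal_FG_zero_left {ε : ℝ} (hε : 0 < ε) (β : Measure Ω) :
    (FG ε 0 β).toReal = (1 + ε / 2) * (hat β).real Set.univ := by
  rw [FG, if_pos rfl, ENNReal.toReal_mul, ENNReal.toReal_ofReal (by positivity), toReal_pers]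

theorem toReal_FG_zero_right {ε : ℝ} (hε : 0 < ε) (α : Measure Ω) :
    (FG ε α 0).toReal = (1 + ε / 2) * (hat α).real Set.univ := by
  rcases eq_or_ne α 0 with rfl | h
  · exact toReal_FG_zero_left hε 0
  · rw [FG, if_neg h, if_pos rfl, ENNReal.toReal_mul, ENNReal.toReal_ofReal (by positivity),
      toReal_pers]

theorem FG_zero_zero (ε : ℝ) : FG ε (0 : Measure Ω) 0 = 0 := by simp [FG, pers]

theorem SkFG_nonneg_and_eq_zero_iff (hpos : ∀ x : Ω, 0 < costBdry x)
    (hΩb : Bornology.IsBounded Ω) {ε : ℝ} (hε : 0 < ε)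
    (hK : IsPosDefKernel (Ω := Ω) (expKernel ε)) {α β : Measure Ω}
    (hα : FinPers α) (hβ : FinPers β) : 0 ≤ SkFG ε α β ∧ (SkFG ε α β = 0 ↔ α = β) := by
  have hself : α = β → SkFG ε α β = 0 := by
    rintro rfl
    rw [SkFG]; ring
  suffices h : 0 ≤ SkFG ε α β ∧ (SkFG ε α β = 0 → α = β) from ⟨h.1, h.2, hself⟩
  rcases eq_or_ne α 0 with rfl | hα0
  · rcases eq_or_ne β 0 with rfl | hβ0
    · exact ⟨(hself rfl).ge, fun _ => rfl⟩
    · have := FG_self_lt hpos hΩb hε hβ hβ0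
      have h : 0 < SkFG ε 0 β := by
        rw [SkFG, toReal_FG_zero_left hε, FG_zero_zero, ENNReal.toReal_zero]
        linarith
      exact ⟨h.le, fun h' => absurd h' h.ne'⟩
  · rcases eq_or_ne β 0 with rfl | hβ0
    · have := FG_self_lt hpos hΩb hε hα hα0
      have h : 0 < SkFG ε α 0 := by
        rw [SkFG, toReal_FG_zero_right hε, FG_zero_zero, ENNReal.toReal_zero]
        linarith
      exact ⟨h.le, fun h' => absurd h' h.ne'⟩
    · exact SkFG_nonneg_of_ne_zero hpos hΩb hε hK hα hβ hα0 hβ0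

end

noncomputable section

variable {d : ℕ} {Ω : Set (E d)}

theorem abs_exp_neg_sub_exp_neg_le {s t : ℝ} (hs : 0 ≤ s) (ht : 0 ≤ t) :
    |Real.exp (-s) - Real.exp (-t)| ≤ |s - t| := by
  have key : ∀ {s t : ℝ}, 0 ≤ s → s ≤ t → |Real.exp (-s) - Real.exp (-t)| ≤ |s - t| := by
    intro s t hs hst
    have h1 : Real.exp (-t) ≤ Real.exp (-s) := Real.exp_le_exp.2 (neg_le_neg hst)
    rw [abs_of_nonneg (sub_nonneg.2 h1), abs_of_nonpos (sub_nonpos.2 hst)]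
    have h2 : Real.exp (-t) = Real.exp (-s) * Real.exp (-(t - s)) := by
      rw [← Real.exp_add]; congr 1; ring
    have h3 := Real.add_one_le_exp (-(t - s))
    have h4 : Real.exp (-s) ≤ 1 := Real.exp_le_one_iff.2 (neg_nonpos.2 hs)
    have h5 := Real.exp_pos (-s)
    rw [h2]
    nlinarith [Real.exp_pos (-(t - s))]
  rcases le_total s t with h | h
  · exact key hs h
  · rw [abs_sub_comm, abs_sub_comm s]; exact key ht h

theorem exists_expKernel_lipschitz (hΩb : Bornology.IsBounded Ω) {ε : ℝ} (hε : 0 < ε) :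
    ∃ L, 0 ≤ L ∧ ∀ x x' y : Ω, |expKernel ε x y - expKernel ε x' y| ≤ L * dist x x' := by
  obtain ⟨D, hD⟩ := Metric.isBounded_iff.1 hΩb
  refine ⟨2 * max D 0 / ε, by positivity, fun x x' y => ?_⟩
  have h1 : dist (x : E d) y ≤ max D 0 := (hD x.2 y.2).trans (le_max_left _ _)
  have h2 : dist (x' : E d) y ≤ max D 0 := (hD x'.2 y.2).trans (le_max_left _ _)
  have h3 : |dist (x : E d) y - dist (x' : E d) y| ≤ dist x x' := abs_dist_sub_le _ _ _
  simp only [expKernel, neg_div]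
  refine (abs_exp_neg_sub_exp_neg_le (div_nonneg (cost_nonneg _ _) hε.le)
    (div_nonneg (cost_nonneg _ _) hε.le)).trans ?_
  rw [← sub_div, abs_div, abs_of_pos hε, div_mul_eq_mul_div]
  refine div_le_div_of_nonneg_right ?_ hε.le
  have e : cost (x : E d) y - cost (x' : E d) y
      = (dist (x : E d) y + dist (x' : E d) y) * (dist (x : E d) y - dist (x' : E d) y) := by
    simp only [cost, ← dist_eq_norm]; ring
  rw [e, abs_mul, abs_of_nonneg (by positivity)]
  exact mul_le_mul (by linarith) h3 (abs_nonneg _) (by positivity)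

theorem WeakConv.tendsto_integral {μs : ℕ → Measure Ω} {μ : Measure Ω} (h : WeakConv μs μ)
    {f : Ω → ℝ} (hf : IsBC f) : Tendsto (fun n => ∫ x, f x ∂(μs n)) atTop (𝓝 (∫ x, f x ∂μ)) :=
  h hf.toBCF

theorem WeakConv.tendsto_mass {μs : ℕ → Measure Ω} {μ : Measure Ω} (h : WeakConv μs μ) :
    Tendsto (fun n => (μs n).real Set.univ) atTop (𝓝 (μ.real Set.univ)) := by
  simpa using h.tendsto_integral (IsBC.const 1)

theorem WeakConv.tendsto_geomMass {μs νs : ℕ → Measure Ω} {μ ν : Measure Ω} (h : WeakConv μs μ)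
    (h' : WeakConv νs ν) :
    Tendsto (fun n => geomMass (μs n) (νs n)) atTop (𝓝 (geomMass μ ν)) :=
  (h.tendsto_mass.mul h'.tendsto_mass).sqrt

theorem isBC_expKernel (ε : ℝ) (hε : 0 < ε) (x : Ω) : IsBC fun y => expKernel ε x y := by
  have h : Continuous fun y : Ω => -cost (x : E d) (y : E d) / ε :=
    (continuous_cost.comp (Continuous.prodMk_right x)).neg.div_const ε
  refine IsBC.of_nonneg_of_le (C := 1) h.rexp (fun y => (Real.exp_pos _).le) fun y => ?_
  exact Real.exp_le_one_iff.2 (div_nonpos_of_nonpos_of_nonneg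
    (neg_nonpos.2 (cost_nonneg _ _)) hε.le)

theorem abs_integral_expKernel_sub_le {ε : ℝ} (hε : 0 < ε) {b : Measure Ω} [IsFiniteMeasure b]
    {q : Ω → ℝ} (hq : IsBC q) {C L : ℝ} (hC0 : 0 ≤ C) (hC : ∀ x, |q x| ≤ C)
    (hL : ∀ x x' y : Ω, |expKernel ε x y - expKernel ε x' y| ≤ L * dist x x') (x x' : Ω) :
    |∫ y, q y * expKernel ε x y ∂b - ∫ y, q y * expKernel ε x' y ∂b|
      ≤ C * (L * dist x x') * b.real Set.univ := by
  rw [← integral_sub ((hq.mul (isBC_expKernel ε hε x)).integrable b)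
    ((hq.mul (isBC_expKernel ε hε x')).integrable b), ← Real.norm_eq_abs]
  refine norm_integral_le_of_norm_le_const (Eventually.of_forall fun y => ?_)
  rw [← mul_sub, Real.norm_eq_abs, abs_mul]
  exact mul_le_mul (hC y) (hL x x' y) (abs_nonneg _) hC0

theorem IsBC.exists_bound {X : Type*} [TopologicalSpace X] {f : X → ℝ} (hf : IsBC f) :
    ∃ C, 0 ≤ C ∧ ∀ x, |f x| ≤ C := by
  obtain ⟨C, hC⟩ := hf.bounded
  exact ⟨max C 0, le_max_right _ _, fun x => (hC x).trans (le_max_left _ _)⟩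

theorem isBC_integral_expKernel (hΩb : Bornology.IsBounded Ω) {ε : ℝ} (hε : 0 < ε)
    (b : Measure Ω) [IsFiniteMeasure b] {q : Ω → ℝ} (hq : IsBC q) :
    IsBC fun x => ∫ y, q y * expKernel ε x y ∂b := by
  obtain ⟨C, hC0, hC⟩ := hq.exists_bound
  obtain ⟨L, hL0, hL⟩ := exists_expKernel_lipschitz hΩb hε
  refine ⟨?_, C * b.real Set.univ, fun x => ?_⟩
  · refine (LipschitzWith.of_dist_le_mul (K := NNReal.mk (C * L * b.real Set.univ)
      (mul_nonneg (mul_nonneg hC0 hL0) measureReal_nonneg)) fun x x' => ?_).continuous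
    refine (abs_integral_expKernel_sub_le hε hq hC0 hC hL x x').trans_eq ?_
    rw [NNReal.coe_mk]; ring
  · rw [← Real.norm_eq_abs]
    refine norm_integral_le_of_norm_le_const (Eventually.of_forall fun y => ?_)
    rw [Real.norm_eq_abs, abs_mul, expKernel, Real.abs_exp]
    refine (mul_le_of_le_one_right (abs_nonneg _) (Real.exp_le_one_iff.2 ?_)).trans (hC y)
    exact div_nonpos_of_nonpos_of_nonneg (neg_nonpos.2 (cost_nonneg _ _)) hε.le

/-- The integrals of the exponential kernel against a weakly convergent sequence converge
uniformly. -/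
theorem WeakConv.eventually_abs_integral_expKernel_sub_le (hΩb : Bornology.IsBounded Ω) {ε : ℝ}
    (hε : 0 < ε) {bs : ℕ → Measure Ω} {b : Measure Ω} [∀ n, IsFiniteMeasure (bs n)]
    [IsFiniteMeasure b] (h : WeakConv bs b) {q : Ω → ℝ} (hq : IsBC q) {η : ℝ} (hη : 0 < η) :
    ∀ᶠ n in atTop, ∀ x, |∫ y, q y * expKernel ε x y ∂(bs n) - ∫ y, q y * expKernel ε x y ∂b|
      ≤ η := by
  obtain ⟨C, hC0, hC⟩ := hq.exists_bound
  obtain ⟨L, hL0, hL⟩ := exists_expKernel_lipschitz hΩb hε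
  set M := b.real Set.univ + 1 with hM
  have hM0 : 0 < M := by positivity
  set r := η / (3 * (C * L * M + 1)) with hr
  have hr0 : 0 < r := by positivity
  have hrη : C * (L * r) * M ≤ η / 3 := by
    rw [hr]
    have : C * (L * (η / (3 * (C * L * M + 1)))) * M = η / 3 * (C * L * M / (C * L * M + 1)) := by
      field_simp
    rw [this]
    refine mul_le_of_le_one_right (by positivity) ((div_le_one (by positivity)).2 (by linarith))
  have htb : TotallyBounded Ω := hΩb.isCompact_closure.totallyBounded.subset subset_closure
  obtain ⟨T, hTs, hTf, hT⟩ := Metric.finite_approx_of_totallyBounded htb r hr0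
  have hpt : ∀ᶠ n in atTop, ∀ z ∈ T, ∀ hz : z ∈ Ω,
      |∫ y, q y * expKernel ε ⟨z, hz⟩ y ∂(bs n) - ∫ y, q y * expKernel ε ⟨z, hz⟩ y ∂b| < η / 3 := by
    rw [eventually_all_finite hTf]
    intro z hzT
    have := h.tendsto_integral (hq.mul (isBC_expKernel ε hε ⟨z, hTs hzT⟩))
    filter_upwards [Metric.tendsto_nhds.1 this (η / 3) (by positivity)] with n hn _
    exact hn
  have hmass : ∀ᶠ n in atTop, (bs n).real Set.univ ≤ M :=
    h.tendsto_mass.eventually_le_const (by linarith)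
  filter_upwards [hpt, hmass] with n hn hmn x
  obtain ⟨z, hzT, hxz⟩ := Set.mem_iUnion₂.1 (hT x.2)
  have hz := hTs hzT
  have hd : dist x ⟨z, hz⟩ ≤ r := (Metric.mem_ball.1 hxz).le
  have hB : ∀ (μ : Measure Ω) [IsFiniteMeasure μ], μ.real Set.univ ≤ M →
      |∫ y, q y * expKernel ε x y ∂μ - ∫ y, q y * expKernel ε ⟨z, hz⟩ y ∂μ| ≤ η / 3 := by
    intro μ _ hμ
    refine (abs_integral_expKernel_sub_le hε hq hC0 hC hL x ⟨z, hz⟩).trans (le_trans ?_ hrη)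
    gcongr
  have h1 := abs_le.1 (hB (bs n) hmn)
  have h2 := abs_le.1 (hB b (by linarith))
  have h3 := abs_lt.1 (hn z hzT hz)
  exact abs_le.2 ⟨by linarith, by linarith⟩

theorem isBC_exp_costBdry (hΩb : Bornology.IsBounded Ω) (ε : ℝ) :
    IsBC fun x : Ω => Real.exp (costBdry x / ε) :=
  ((isBC_costBdry hΩb).div_const ε).exp

theorem integral_mul_gibbs_eq (ε : ℝ) (b : Measure Ω) (q : Ω → ℝ) (x : Ω) :
    ∫ y, q y * gibbs ε x y ∂b = Real.exp (costBdry x / ε)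
      * ∫ y, (q y * Real.exp (costBdry y / ε)) * expKernel ε x y ∂b := by
  rw [← integral_const_mul]
  refine integral_congr_ae (Eventually.of_forall fun y => ?_)
  simp only [gibbs_eq]
  ring

theorem isBC_integral_gibbs (hΩb : Bornology.IsBounded Ω) {ε : ℝ} (hε : 0 < ε)
    (b : Measure Ω) [IsFiniteMeasure b] {q : Ω → ℝ} (hq : IsBC q) :
    IsBC fun x => ∫ y, q y * gibbs ε x y ∂b := by
  simp only [integral_mul_gibbs_eq]
  exact (isBC_exp_costBdry hΩb ε).mul
    (isBC_integral_expKernel hΩb hε b (hq.mul (isBC_exp_costBdry hΩb ε)))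

theorem WeakConv.eventually_abs_integral_gibbs_sub_le (hΩb : Bornology.IsBounded Ω) {ε : ℝ}
    (hε : 0 < ε) {bs : ℕ → Measure Ω} {b : Measure Ω} [∀ n, IsFiniteMeasure (bs n)]
    [IsFiniteMeasure b] (h : WeakConv bs b) {q : Ω → ℝ} (hq : IsBC q) {η : ℝ} (hη : 0 < η) :
    ∀ᶠ n in atTop, ∀ x, |∫ y, q y * gibbs ε x y ∂(bs n) - ∫ y, q y * gibbs ε x y ∂b| ≤ η := by
  obtain ⟨C, hC0, hC⟩ := (isBC_exp_costBdry hΩb ε).exists_bound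
  filter_upwards [h.eventually_abs_integral_expKernel_sub_le hΩb hε
    (hq.mul (isBC_exp_costBdry hΩb ε)) (η := η / (C + 1)) (by positivity)] with n hn x
  rw [integral_mul_gibbs_eq, integral_mul_gibbs_eq, ← mul_sub, abs_mul]
  refine (mul_le_mul (hC x) (hn x) (abs_nonneg _) hC0).trans ?_
  rw [mul_div_assoc', div_le_iff₀ (by positivity)]
  nlinarith

theorem integral_prod_mul_gibbs (hΩb : Bornology.IsBounded Ω) (ε : ℝ) (a b : Measure Ω)
    [IsFiniteMeasure a] [IsFiniteMeasure b] {p q : Ω → ℝ} (hp : IsBC p) (hq : IsBC q) :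
    ∫ z, p z.1 * q z.2 * gibbs ε z.1 z.2 ∂(a.prod b)
      = ∫ x, p x * ∫ y, q y * gibbs ε x y ∂b ∂a := by
  rw [integral_prod _ ((((hp.comp continuous_fst).mul (hq.comp continuous_snd)).mul
    (isBC_gibbs hΩb ε)).integrable _)]
  simp only [mul_assoc, integral_const_mul]

theorem WeakConv.tendsto_integral_prod_gibbs (hΩb : Bornology.IsBounded Ω) {ε : ℝ}
    (hε : 0 < ε) {as bs : ℕ → Measure Ω} {a b : Measure Ω} [∀ n, IsFiniteMeasure (as n)]
    [∀ n, IsFiniteMeasure (bs n)] [IsFiniteMeasure a] [IsFiniteMeasure b] (ha : WeakConv as a)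
    (hb : WeakConv bs b) {p q : Ω → ℝ} (hp : IsBC p) (hq : IsBC q) :
    Tendsto (fun n => ∫ z, p z.1 * q z.2 * gibbs ε z.1 z.2 ∂((as n).prod (bs n))) atTop
      (𝓝 (∫ z, p z.1 * q z.2 * gibbs ε z.1 z.2 ∂(a.prod b))) := by
  simp only [integral_prod_mul_gibbs hΩb ε _ _ hp hq]
  obtain ⟨C, hC0, hC⟩ := hp.exists_bound
  have hG := isBC_integral_gibbs hΩb hε b hq
  have h1 := ha.tendsto_integral (hp.mul hG)
  have h2 : Tendsto (fun n => ∫ x, p x * ∫ y, q y * gibbs ε x y ∂(bs n) ∂(as n)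
      - ∫ x, p x * ∫ y, q y * gibbs ε x y ∂b ∂(as n)) atTop (𝓝 0) := by
    rw [Metric.tendsto_nhds]
    intro η hη
    set M := a.real Set.univ + 1 with hM
    have hM0 : 0 < M := by positivity
    have hmass : ∀ᶠ n in atTop, (as n).real Set.univ ≤ M :=
      ha.tendsto_mass.eventually_le_const (by linarith)
    filter_upwards [hmass, hb.eventually_abs_integral_gibbs_sub_le hΩb hε hq
      (η := η / (C * M + 1)) (by positivity)] with n hn hun
    rw [Real.dist_eq, sub_zero, ← integral_sub
      ((hp.mul (isBC_integral_gibbs hΩb hε (bs n) hq)).integrable _)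
      ((hp.mul hG).integrable _), ← Real.norm_eq_abs]
    refine lt_of_le_of_lt (norm_integral_le_of_norm_le_const (C := C * (η / (C * M + 1)))
      (Eventually.of_forall fun x => ?_)) ?_
    · rw [← mul_sub, Real.norm_eq_abs, abs_mul]
      exact mul_le_mul (hC x) (hun x) (abs_nonneg _) hC0
    · calc C * (η / (C * M + 1)) * (as n).real Set.univ ≤ C * (η / (C * M + 1)) * M := by gcongr
        _ = η * (C * M / (C * M + 1)) := by ring
        _ < η := mul_lt_of_lt_one_right hη ((div_lt_one (by positivity)).2 (by linarith))
  simpa using h2.add h1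

theorem WeakConv.tendsto_dualVal (hpos : ∀ x : Ω, 0 < costBdry x) (hΩb : Bornology.IsBounded Ω)
    {ε : ℝ} (hε : 0 < ε) {as bs : ℕ → Measure Ω} {a b : Measure Ω} [∀ n, IsFiniteMeasure (as n)]
    [∀ n, IsFiniteMeasure (bs n)] [IsFiniteMeasure a] [IsFiniteMeasure b] (ha : WeakConv as a)
    (hb : WeakConv bs b) (hg : geomMass a b ≠ 0) {u v : Ω → ℝ} (hu : IsPot u) (hv : IsPot v) :
    Tendsto (fun n => dualVal ε (as n) (bs n) u v) atTop (𝓝 (dualVal ε a b u v)) := by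
  refine ((ha.tendsto_mass.add hb.tendsto_mass).const_mul _).add (Tendsto.const_mul _ ?_)
  exact ((ha.tendsto_integral (hu.isBC_log_div hpos)).add
    (hb.tendsto_integral (hv.isBC_log_div hpos))).sub
    ((ha.tendsto_integral_prod_gibbs hΩb hε hb hu.isBC hv.isBC).div (ha.tendsto_geomMass hb) hg)

theorem WeakConv.tendsto_gibbsVal (hpos : ∀ x : Ω, 0 < costBdry x)
    (hΩb : Bornology.IsBounded Ω) {ε : ℝ} (hε : 0 < ε) {as bs : ℕ → Measure Ω} {a b : Measure Ω}
    [∀ n, IsFiniteMeasure (as n)] [∀ n, IsFiniteMeasure (bs n)] [IsFiniteMeasure a]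
    [IsFiniteMeasure b] (ha : WeakConv as a) (hb : WeakConv bs b) (hg : geomMass a b ≠ 0)
    {u v : Ω → ℝ} (hu : IsPot u) (hv : IsPot v) (s : ℝ) :
    Tendsto (fun n => gibbsVal ε (as n) (bs n) u v s) atTop (𝓝 (gibbsVal ε a b u v s)) := by
  simp only [gibbsVal_eq hpos hΩb ε _ _ hu hv]
  have bu := hu.isBC.mul (hu.isBC_log hpos hΩb)
  have bv := hv.isBC.mul (hv.isBC_log hpos hΩb)
  refine ((ha.tendsto_mass.add hb.tendsto_mass).const_mul _).add (Tendsto.const_mul _ ?_)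
  exact (tendsto_const_nhds.div (ha.tendsto_geomMass hb) hg).mul
    (((ha.tendsto_integral_prod_gibbs hΩb hε hb hu.isBC hv.isBC).const_mul _).add
      ((ha.tendsto_integral_prod_gibbs hΩb hε hb bu hv.isBC).add
        (ha.tendsto_integral_prod_gibbs hΩb hε hb hu.isBC bv)))

theorem continuousAt_gibbsVal_one (hpos : ∀ x : Ω, 0 < costBdry x)
    (hΩb : Bornology.IsBounded Ω) {ε : ℝ} {a b : Measure Ω} [IsFiniteMeasure a]
    [IsFiniteMeasure b] {u v : Ω → ℝ} (hu : IsPot u) (hv : IsPot v) :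
    ContinuousAt (gibbsVal ε a b u v) 1 := by
  have : gibbsVal ε a b u v = fun s => _ := funext (gibbsVal_eq hpos hΩb ε a b hu hv)
  rw [this]
  have hl : ContinuousAt Real.log 1 := Real.continuousAt_log one_ne_zero
  fun_prop

/-- Approximate feasibility is stable under weak convergence. -/
theorem WeakConv.eventually_feasible (hΩb : Bornology.IsBounded Ω) {ε : ℝ} (hε : 0 < ε)
    {bs : ℕ → Measure Ω} {b : Measure Ω} [∀ n, IsFiniteMeasure (bs n)] [IsFiniteMeasure b]
    (h : WeakConv bs b) {gs : ℕ → ℝ} {g : ℝ} (hgs : Tendsto gs atTop (𝓝 g)) (hg : 0 < g)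
    {u v : Ω → ℝ} (hu : IsPot u) (hv : IsPot v) {s : ℝ} (hs0 : 0 < s) (hs : s < 1)
    (hf : ∀ x, costBdry x * u x * ((∫ y, v y * gibbs ε x y ∂b) / g) ≤ 1) :
    ∀ᶠ n in atTop, ∀ x, s * (costBdry x * u x * ((∫ y, v y * gibbs ε x y ∂(bs n)) / gs n)) ≤ 1 := by
  obtain ⟨B, hB0, hB⟩ := exists_costBdry_le hΩb
  set η := (1 - s) * g / (B + 1) with hη
  have hη0 : 0 < η := div_pos (mul_pos (sub_pos.2 hs) hg) (by positivity)
  have hBη : B * η ≤ (1 - s) * g := by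
    rw [hη, mul_div_assoc', div_le_iff₀ (by positivity)]
    nlinarith [mul_pos (sub_pos.2 hs) hg]
  have hlt : s * (B * η + g) < g := by
    have : 0 < (1 - s) ^ 2 * g := mul_pos (pow_pos (sub_pos.2 hs) 2) hg
    nlinarith
  filter_upwards [h.eventually_abs_integral_gibbs_sub_le hΩb hε hv.isBC hη0,
    hgs.eventually_const_lt hlt] with n hn hgn x
  have hgn0 : 0 < gs n := lt_of_le_of_lt (by positivity) hgn
  have hx := hf x
  rw [mul_div_assoc', div_le_one hg] at hx
  rw [mul_div_assoc', mul_div_assoc', div_le_one hgn0]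
  refine le_trans (mul_le_mul_of_nonneg_left ?_ hs0.le) hgn.le
  have h1 := (abs_le.1 (hn x)).2
  have hcu : costBdry x * u x ≤ B :=
    (mul_le_of_le_one_right (costBdry_nonneg x) (hu.le_one x)).trans (hB x)
  have hcu0 : 0 ≤ costBdry x * u x := mul_nonneg (costBdry_nonneg x) (hu.pos x).le
  calc costBdry x * u x * ∫ y, v y * gibbs ε x y ∂(bs n)
      ≤ costBdry x * u x * (η + ∫ y, v y * gibbs ε x y ∂b) :=
        mul_le_mul_of_nonneg_left (by linarith) hcu0
    _ = costBdry x * u x * η + costBdry x * u x * ∫ y, v y * gibbs ε x y ∂b := by ring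
    _ ≤ B * η + g := add_le_add (mul_le_mul_of_nonneg_right hcu hη0.le) hx

theorem WeakConv.eventually_ne_zero {μs : ℕ → Measure Ω} {μ : Measure Ω} [IsFiniteMeasure (hat μ)]
    (h : WeakConv (fun n => hat (μs n)) (hat μ)) (hμ : hat μ ≠ 0) : ∀ᶠ n in atTop, μs n ≠ 0 := by
  filter_upwards [h.tendsto_mass.eventually_const_lt (measureReal_univ_pos hμ)] with n hn h0
  rw [h0, hat_zero] at hn
  simp at hn

theorem tendsto_toReal_FG_of_ne_zero (hpos : ∀ x : Ω, 0 < costBdry x)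
    (hΩb : Bornology.IsBounded Ω) {ε : ℝ} (hε : 0 < ε) {αs βs : ℕ → Measure Ω} {α β : Measure Ω}
    (hαs : ∀ n, FinPers (αs n)) (hβs : ∀ n, FinPers (βs n)) (hα : FinPers α) (hβ : FinPers β)
    (ha : WeakConv (fun n => hat (αs n)) (hat α)) (hb : WeakConv (fun n => hat (βs n)) (hat β))
    (hα0 : α ≠ 0) (hβ0 : β ≠ 0) :
    Tendsto (fun n => (FG ε (αs n) (βs n)).toReal) atTop (𝓝 (FG ε α β).toReal) := by
  have := hα.isFiniteMeasure_hat
  have := hβ.isFiniteMeasure_hat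
  have := fun n => (hαs n).isFiniteMeasure_hat
  have := fun n => (hβs n).isFiniteMeasure_hat
  have ha0 := mt (hat_eq_zero_iff hpos).1 hα0
  have hb0 := mt (hat_eq_zero_iff hpos).1 hβ0
  have hg := geomMass_pos ha0 hb0
  obtain ⟨u, v, hu, hv, h1, h2, hFG⟩ := exists_FG_eq_dualVal hpos hΩb hε hα hβ hα0 hβ0
  have hαn := ha.eventually_ne_zero ha0
  have hβn := hb.eventually_ne_zero hb0
  refine tendsto_order.2 ⟨fun y hy => ?_, fun y hy => ?_⟩
  · rw [hFG] at hy
    filter_upwards [hαn, hβn, (ha.tendsto_dualVal hpos hΩb hε hb hg.ne' hu hv).eventually_const_lt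
      hy] with n hn1 hn2 hn3
    exact hn3.trans_le (dualVal_le_FG hpos hΩb hε (hαs n) (hβs n) hn1 hn2 hu hv)
  · rw [hFG, ← gibbsVal_one hpos hΩb hu hv h1 h2] at hy
    have hev : ∀ᶠ s in 𝓝[<] (1 : ℝ), gibbsVal ε (hat α) (hat β) u v s < y :=
      ((continuousAt_gibbsVal_one hpos hΩb hu hv).eventually_lt_const hy).filter_mono
        nhdsWithin_le_nhds
    have hIoo : ∀ᶠ s in 𝓝[<] (1 : ℝ), s ∈ Set.Ioo 0 1 := Ioo_mem_nhdsLT zero_lt_one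
    obtain ⟨s, hsy, hs0, hs1⟩ := (hev.and hIoo).exists
    have hgt := ha.tendsto_geomMass hb
    have f1 := hb.eventually_feasible hΩb hε hgt hg hu hv hs0 hs1 fun x => by
      nth_rewrite 1 [h1]; exact costBdry_mul_sinkPot_le _ _ _
    have f2 := ha.eventually_feasible hΩb hε hgt hg hv hu hs0 hs1 fun x => by
      nth_rewrite 1 [h2]; exact costBdry_mul_sinkPot_le _ _ _
    filter_upwards [hαn, hβn, f1, f2, (ha.tendsto_gibbsVal hpos hΩb hε hb hg.ne' hu hv
      s).eventually_lt_const hsy] with n hn1 hn2 hn3 hn4 hn5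
    exact (FG_le_of_feasible hpos hΩb hε (hαs n) (hβs n) hn1 hn2 hu hv hs0 hn3 hn4).trans_lt hn5

theorem isPot_one : IsPot fun _ : Ω => (1 : ℝ) :=
  ⟨continuous_const, fun _ => one_pos, fun _ => le_rfl, 0, fun x => by simp⟩

theorem toReal_FG_le (hpos : ∀ x : Ω, 0 < costBdry x) (hΩb : Bornology.IsBounded Ω) {ε : ℝ}
    (hε : 0 < ε) {α β : Measure Ω} (hα : FinPers α) (hβ : FinPers β) :
    (FG ε α β).toReal ≤ (1 + ε / 2) * ((hat α).real Set.univ + (hat β).real Set.univ) := by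
  rcases eq_or_ne α 0 with rfl | hα0
  · rw [toReal_FG_zero_left hε, hat_zero]; simp
  rcases eq_or_ne β 0 with rfl | hβ0
  · rw [toReal_FG_zero_right hε, hat_zero]; simp
  have := hα.isFiniteMeasure_hat
  have := hβ.isFiniteMeasure_hat
  obtain ⟨u, v, hu, hv, -, -, hFG⟩ := exists_FG_eq_dualVal hpos hΩb hε hα hβ hα0 hβ0
  rw [hFG]
  unfold dualVal
  have l1 : ∀ {w : Ω → ℝ} (μ : Measure Ω), IsPot w → ∫ x, Real.log (w x) / costBdry x ∂μ ≤ 0 :=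
    fun μ hw => integral_nonpos fun x =>
      div_nonpos_of_nonpos_of_nonneg (hw.log_nonpos x) (hpos x).le
  have l2 : 0 ≤ (∫ p, u p.1 * v p.2 * gibbs ε p.1 p.2 ∂((hat α).prod (hat β)))
      / geomMass (hat α) (hat β) :=
    div_nonneg (integral_nonneg fun p =>
      (mul_pos (mul_pos (hu.pos _) (hv.pos _)) (gibbs_pos _ _ _)).le) (Real.sqrt_nonneg _)
  nlinarith [l1 (hat α) hu, l1 (hat β) hv]

theorem le_toReal_FG (hpos : ∀ x : Ω, 0 < costBdry x) (hΩb : Bornology.IsBounded Ω) {ε : ℝ}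
    (hε : 0 < ε) {K : ℝ} (hK0 : 0 ≤ K) (hK : ∀ x y : Ω, gibbs ε x y ≤ K) {α β : Measure Ω}
    (hα : FinPers α) (hβ : FinPers β) :
    (1 + ε / 2) * ((hat α).real Set.univ + (hat β).real Set.univ)
      - ε * (K * geomMass (hat α) (hat β)) ≤ (FG ε α β).toReal := by
  have hnn : 0 ≤ ε * (K * geomMass (hat α) (hat β)) :=
    mul_nonneg hε.le (mul_nonneg hK0 (Real.sqrt_nonneg _))
  rcases eq_or_ne α 0 with rfl | hα0
  · rw [toReal_FG_zero_left hε, hat_zero]; simp [geomMass]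
  rcases eq_or_ne β 0 with rfl | hβ0
  · rw [toReal_FG_zero_right hε, hat_zero]; simp [geomMass]
  have := hα.isFiniteMeasure_hat
  have := hβ.isFiniteMeasure_hat
  have hg := geomMass_pos (mt (hat_eq_zero_iff hpos).1 hα0) (mt (hat_eq_zero_iff hpos).1 hβ0)
  refine le_trans ?_ (dualVal_le_FG hpos hΩb hε hα hβ hα0 hβ0 isPot_one isPot_one)
  unfold dualVal
  have h1 : ∫ p, gibbs ε p.1 p.2 ∂((hat α).prod (hat β))
      ≤ K * (geomMass (hat α) (hat β) * geomMass (hat α) (hat β)) := by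
    rw [geomMass, Real.mul_self_sqrt (mul_nonneg measureReal_nonneg measureReal_nonneg),
      ← measureReal_prod_univ]
    have := integral_mono ((isBC_gibbs hΩb ε).integrable ((hat α).prod (hat β)))
      (integrable_const K) fun p => hK p.1 p.2
    simpa [mul_comm] using this
  have h2 : (∫ p, gibbs ε p.1 p.2 ∂((hat α).prod (hat β))) / geomMass (hat α) (hat β)
      ≤ K * geomMass (hat α) (hat β) := by
    rw [div_le_iff₀ hg, mul_assoc]; exact h1
  simp only [Real.log_one, zero_div, integral_zero, one_mul, add_zero, zero_sub]
  nlinarith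

theorem tendsto_toReal_FG_of_geomMass_eq_zero (hpos : ∀ x : Ω, 0 < costBdry x)
    (hΩb : Bornology.IsBounded Ω) {ε : ℝ} (hε : 0 < ε) {αs βs : ℕ → Measure Ω} {α β : Measure Ω}
    (hαs : ∀ n, FinPers (αs n)) (hβs : ∀ n, FinPers (βs n)) (hα : FinPers α) (hβ : FinPers β)
    (ha : WeakConv (fun n => hat (αs n)) (hat α)) (hb : WeakConv (fun n => hat (βs n)) (hat β))
    (hg : geomMass (hat α) (hat β) = 0) :
    Tendsto (fun n => (FG ε (αs n) (βs n)).toReal) atTop (𝓝 (FG ε α β).toReal) := by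
  obtain ⟨K, hK0, hK⟩ := exists_gibbs_le hΩb ε
  have e : (FG ε α β).toReal
      = (1 + ε / 2) * ((hat α).real Set.univ + (hat β).real Set.univ) := by
    refine le_antisymm (toReal_FG_le hpos hΩb hε hα hβ) ?_
    simpa [hg] using le_toReal_FG hpos hΩb hε hK0 hK hα hβ
  have hup : Tendsto (fun n => (1 + ε / 2)
      * ((hat (αs n)).real Set.univ + (hat (βs n)).real Set.univ)) atTop
      (𝓝 ((1 + ε / 2) * ((hat α).real Set.univ + (hat β).real Set.univ))) :=
    (ha.tendsto_mass.add hb.tendsto_mass).const_mul _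
  have hlow := hup.sub (((ha.tendsto_geomMass hb).const_mul K).const_mul ε)
  rw [hg, mul_zero, mul_zero, sub_zero] at hlow
  rw [e]
  exact tendsto_of_tendsto_of_tendsto_of_le_of_le hlow hup
    (fun n => le_toReal_FG hpos hΩb hε hK0 hK (hαs n) (hβs n))
    (fun n => toReal_FG_le hpos hΩb hε (hαs n) (hβs n))

/-- Continuity of `FG` along weakly convergent renormalized measures. -/
theorem tendsto_FG (hpos : ∀ x : Ω, 0 < costBdry x)
    (hΩb : Bornology.IsBounded Ω) {ε : ℝ} (hε : 0 < ε) {αs βs : ℕ → Measure Ω} {α β : Measure Ω}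
    (hαs : ∀ n, FinPers (αs n)) (hβs : ∀ n, FinPers (βs n)) (hα : FinPers α) (hβ : FinPers β)
    (ha : WeakConv (fun n => hat (αs n)) (hat α)) (hb : WeakConv (fun n => hat (βs n)) (hat β)) :
    Tendsto (fun n => FG ε (αs n) (βs n)) atTop (𝓝 (FG ε α β)) := by
  rw [← ENNReal.tendsto_toReal_iff (fun n => FG_ne_top ε (hαs n) (hβs n)) (FG_ne_top ε hα hβ)]
  rcases eq_or_ne α 0 with rfl | hα0
  · exact tendsto_toReal_FG_of_geomMass_eq_zero hpos hΩb hε hαs hβs hα hβ ha hb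
      (by simp [hat_zero, geomMass])
  rcases eq_or_ne β 0 with rfl | hβ0
  · exact tendsto_toReal_FG_of_geomMass_eq_zero hpos hΩb hε hαs hβs hα hβ ha hb
      (by simp [hat_zero, geomMass])
  exact tendsto_toReal_FG_of_ne_zero hpos hΩb hε hαs hβs hα hβ ha hb hα0 hβ0

end

end ROTB

theorem mainTheorem4 {d : ℕ} (hd : 0 < d) (Ω : Set (ROTB.E d)) (hΩ : IsOpen Ω)
    (hΩb : Bornology.IsBounded Ω) (ε : ℝ) (hε : 0 < ε) :
    -- homogeneity of the cost and of the Sinkhorn divergence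
    (∀ α β : Measure Ω, ROTB.FinPers α → ROTB.FinPers β → ∀ l : ℝ≥0,
      ROTB.FG ε (l • α) (l • β) = l * ROTB.FG ε α β ∧
      ROTB.SkFG ε (l • α) (l • β) = l * ROTB.SkFG ε α β) ∧
    -- Sinkhorn iterates, optimal potentials and optimal plans under scaling
    (∀ α β : Measure Ω, ROTB.FinPers α → ROTB.FinPers β → α ≠ 0 → β ≠ 0 → ∀ l : ℝ≥0, 0 < l →
      (∀ f₀ g₀ : C(Ω, ℝ), ∀ t : ℕ,
        ROTB.sinkhorn ε (l • α) (l • β) f₀ g₀ t = ROTB.sinkhorn ε α β f₀ g₀ t) ∧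
      (∀ f g : C(Ω, ℝ),
        ROTB.IsOptimalPotentials ε (l • α) (l • β) f g ↔ ROTB.IsOptimalPotentials ε α β f g) ∧
      (∀ π : FiniteMeasure (Ω × Ω), ROTB.IsOptimalPlan ε α β π →
        ROTB.IsOptimalPlan ε (l • α) (l • β) (l • π))) ∧
    -- continuity, the null measure included
    (∀ (αs βs : ℕ → Measure Ω) (α β : Measure Ω),
      (∀ n, ROTB.FinPers (αs n)) → (∀ n, ROTB.FinPers (βs n)) →
      ROTB.FinPers α → ROTB.FinPers β →
      ROTB.WeakConv (fun n => ROTB.hat (αs n)) (ROTB.hat α) →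
      ROTB.WeakConv (fun n => ROTB.hat (βs n)) (ROTB.hat β) →
      Tendsto (fun n => ROTB.FG ε (αs n) (βs n)) atTop (𝓝 (ROTB.FG ε α β))) ∧
    (∀ β : Measure Ω, ROTB.FinPers β →
      ROTB.FG ε 0 β = ENNReal.ofReal (1 + ε / 2) * ROTB.pers β) ∧
    ROTB.FG ε (0 : Measure Ω) 0 = 0 ∧
    -- positivity of the Sinkhorn divergence
    (ROTB.IsPosDefKernel (Ω := Ω) (ROTB.expKernel ε) →
      ∀ α β : Measure Ω, ROTB.FinPers α → ROTB.FinPers β →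
        0 ≤ ROTB.SkFG ε α β ∧ (ROTB.SkFG ε α β = 0 ↔ α = β)) := by
  have hpos : ∀ x : Ω, 0 < ROTB.costBdry x := ROTB.costBdry_pos hd hΩ hΩb
  refine ⟨fun α β hα hβ l => ⟨ROTB.FG_smul ε hα hβ l, ROTB.SkFG_smul ε hα hβ l⟩,
    fun α β hα hβ _ _ l hl => ⟨fun f₀ g₀ t => ROTB.sinkhorn_smul ε hl.ne' α β f₀ g₀ t,
      fun f g => ROTB.isOptimalPotentials_smul_iff ε hl.ne' hα hβ f g,
      fun π h => h.smul hα hβ hl.ne'⟩,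
    fun αs βs α β hαs hβs hα hβ ha hb => ROTB.tendsto_FG hpos hΩb hε hαs hβs hα hβ ha hb,
    fun β _ => if_pos rfl, ROTB.FG_zero_zero ε,
    fun hK α β hα hβ => ROTB.SkFG_nonneg_and_eq_zero_iff hpos hΩb hε hK hα hβ⟩
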